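/- Let $\Omega\subset\mathbb R^2$ be open (possibly unbounded) and let $\gamma>0$. For $u\in L^2(\Omega)$ put $$\int_\Omega(|u_{x_1}|+|u_{x_2}|):=\sup\Big\{-\int_\Omega u\,\operatorname{div}z\,dx:\ z\in C^1_c(\Omega;\mathbb R^2),\ \max(|z_1|,|z_2|)\le 1\Big\}.$$ Let $BV(\Omega)$ be the set of $u\in L^1(\Omega)$ with finite total variation. Define $\Phi_0,\Phi_1:L^2(\Omega)\to[0,+\infty]$ by $$\Phi_0(u)=\int_\Omega(|u_{x_1}|+|u_{x_2}|)\ \text{ if } u\in BV(\Omega),\qquad \Phi_0(u)=+\infty\ \text{ otherwise},$$ $$\Phi_1(u)=\int_\Omega\Big(\frac{\gamma}{2}|\nabla u|^2+|u_{x_1}|+|u_{x_2}|\Big)dx\ \text{ if } u\in H^1(\Omega),\qquad \Phi_1(u)=+\infty\ \text{ otherwise}.$$ The subdifferential $\partial\Phi_i(u)$ is the set of $\xi\in L^2(\Omega)$ such that $\Phi_i(u)<\infty$ and $\Phi_i(v)\ge\Phi_i(u)+\langle\xi,v-u\rangle_{L^2}$ for all $v\in L^2(\Omega)$. Put $A_i(u)=-\partial\Phi_i(u)$,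 let $D(A_i)=\{u: A_i(u)\neq\emptyset\}$, and for $u\in D(A_i)$ let $A_i^o(u)$ be the (unique) element of $A_i(u)$ of least $L^2$ norm. Let $i\in\{0,1\}$ and $u_0\in D(A_i)$. Then there exists a unique function $u:[0,\infty)\to L^2(\Omega)$ such that (1) $u(t)\in D(A_i)$ for all $t>0$; (2) $\frac{du}{dt}\in L^\infty(0,\infty;L^2(\Omega))$, i.e. $u(t)=u(0)+\int_0^t\frac{du}{dt}(s)\,ds$ for all $t\ge0$ with $\frac{du}{dt}\in L^\infty(0,\infty;L^2(\Omega))$, and $\big\|\frac{du}{dt}\big\|_{L^\infty(0,\infty;L^2(\Omega))}\le\|A_i^o(u_0)\|_{L^2(\Omega)}$; (3) $\frac{du}{dt}(t)\in A_i(u(t))$ for almost every $t\in(0,\infty)$; (4) $u(0)=u_0$. Moreover, $u$ has a right derivative in $L^2(\Omega)$ at every $t\in[0,\infty)$, and $$\frac{d^+u}{dt}(t)=A_i^o(u(t))\qquad\text{for all } t\ge 0.$$ -/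

import Mathlib

open MeasureTheory Set Topology
open scoped ENNReal ContDiff RealInnerProductSpace

noncomputable section

namespace AnisoFlow

/-! ### Multivalued operators on a real Hilbert space -/

section Operators

variable {H : Type*} [NormedAddCommGroup H] [InnerProductSpace ℝ H]

/-- The subdifferential of a functional `Φ : H → (-∞, +∞]`: the set of all `ξ` such that
`Φ u` is finite and `Φ v ≥ Φ u + ⟨ξ, v - u⟩` for every `v`. -/
def subdifferential (Φ : H → EReal) (u : H) : Set H :=
  {ξ | Φ u ≠ ⊤ ∧ ∀ v : H, Φ u + ((inner ℝ ξ (v - u) : ℝ) : EReal) ≤ Φ v}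

/-- The multivalued operator `-∂Φ`. -/
def negSubdifferential (Φ : H → EReal) (u : H) : Set H :=
  {w | -w ∈ subdifferential Φ u}

/-- The domain `D(A)` of a multivalued operator. -/
def domain (A : H → Set H) : Set H := {u | (A u).Nonempty}

open Classical in
/-- The minimal section `A°` of a multivalued operator: `A° u` is the element of least norm of
`A u`. For `A = -∂Φ` and `u ∈ D(A)` it exists and is unique, see `minimalSection_spec` and
`eq_minimalSection`. -/
def minimalSection (A : H → Set H) (u : H) : H :=
  if h : ∃ w ∈ A u, ∀ y ∈ A u, ‖w‖ ≤ ‖y‖ then h.choose else 0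

theorem subdifferential_eq (Φ : H → EReal) (hΦ : ∀ v, Φ v ≠ ⊥) (u : H) (hu : Φ u ≠ ⊤) :
    subdifferential Φ u =
      ⋂ v ∈ {v : H | Φ v ≠ ⊤}, {ξ : H | inner ℝ ξ (v - u) ≤ (Φ v).toReal - (Φ u).toReal} := by
  ext ξ
  simp only [subdifferential, mem_ofPred_eq, mem_iInter]
  have key : ∀ v : H, Φ v ≠ ⊤ → (Φ u + ((inner ℝ ξ (v - u) : ℝ) : EReal) ≤ Φ v ↔
      inner ℝ ξ (v - u) ≤ (Φ v).toReal - (Φ u).toReal) := by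
    intro v hv
    rw [← EReal.coe_toReal hu (hΦ u), ← EReal.coe_toReal hv (hΦ v), ← EReal.coe_add,
      EReal.coe_le_coe_iff]
    simp only [EReal.toReal_coe]
    constructor <;> intro h <;> linarith
  constructor
  · rintro ⟨-, h⟩ v hv
    exact (key v hv).1 (h v)
  · intro h
    refine ⟨hu, fun v => ?_⟩
    by_cases hv : Φ v = ⊤
    · rw [hv]
      exact le_top
    · exact (key v hv).2 (h v hv)

theorem convex_negSubdifferential (Φ : H → EReal) (hΦ : ∀ v, Φ v ≠ ⊥) (u : H) :
    Convex ℝ (negSubdifferential Φ u) := by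
  by_cases hu : Φ u = ⊤
  · have : negSubdifferential Φ u = ∅ := by
      ext w
      simp [negSubdifferential, subdifferential, hu]
    rw [this]
    exact convex_empty
  · have h1 : Convex ℝ (subdifferential Φ u) := by
      rw [subdifferential_eq Φ hΦ u hu]
      refine convex_iInter₂ fun v _ => ?_
      refine convex_halfSpace_le ⟨fun x y => ?_, fun c x => ?_⟩ _
      · exact inner_add_left _ _ _
      · exact real_inner_smul_left _ _ _
    exact h1.neg

theorem isClosed_negSubdifferential (Φ : H → EReal) (hΦ : ∀ v, Φ v ≠ ⊥) (u : H) :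
    IsClosed (negSubdifferential Φ u) := by
  by_cases hu : Φ u = ⊤
  · have : negSubdifferential Φ u = ∅ := by
      ext w
      simp [negSubdifferential, subdifferential, hu]
    rw [this]
    exact isClosed_empty
  · have h1 : IsClosed (subdifferential Φ u) := by
      rw [subdifferential_eq Φ hΦ u hu]
      refine isClosed_biInter fun v _ => ?_
      exact isClosed_le (by fun_prop) continuous_const
    exact h1.preimage continuous_neg

/-- On `D(-∂Φ)` the minimal section is an element of least norm of `-∂Φ(u)`. -/
theorem minimalSection_spec [CompleteSpace H] (Φ : H → EReal) (hΦ : ∀ v, Φ v ≠ ⊥) (u : H)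
    (hu : u ∈ domain (negSubdifferential Φ)) :
    minimalSection (negSubdifferential Φ) u ∈ negSubdifferential Φ u ∧
      ∀ y ∈ negSubdifferential Φ u, ‖minimalSection (negSubdifferential Φ) u‖ ≤ ‖y‖ := by
  have hne : (negSubdifferential Φ u).Nonempty := hu
  have hex : ∃ w ∈ negSubdifferential Φ u, ∀ y ∈ negSubdifferential Φ u, ‖w‖ ≤ ‖y‖ := by
    obtain ⟨w, hw, hmin⟩ := exists_norm_eq_iInf_of_complete_convex hne
      (isClosed_negSubdifferential Φ hΦ u).isComplete (convex_negSubdifferential Φ hΦ u) 0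
    refine ⟨w, hw, fun y hy => ?_⟩
    have h2 : ‖(0 : H) - w‖ ≤ ‖(0 : H) - y‖ := by
      rw [hmin]
      exact ciInf_le ⟨0, by rintro _ ⟨x, rfl⟩; exact norm_nonneg _⟩
        (⟨y, hy⟩ : negSubdifferential Φ u)
    simpa using h2
  unfold minimalSection
  rw [dif_pos hex]
  exact hex.choose_spec

/-- The element of least norm of `-∂Φ(u)` is unique. -/
theorem eq_minimalSection [CompleteSpace H] (Φ : H → EReal) (hΦ : ∀ v, Φ v ≠ ⊥) (u w : H)
    (hw : w ∈ negSubdifferential Φ u) (hmin : ∀ y ∈ negSubdifferential Φ u, ‖w‖ ≤ ‖y‖) :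
    w = minimalSection (negSubdifferential Φ) u := by
  obtain ⟨hm, hm'⟩ := minimalSection_spec Φ hΦ u ⟨w, hw⟩
  set m := minimalSection (negSubdifferential Φ) u
  have hmid : (1 / 2 : ℝ) • w + (1 / 2 : ℝ) • m ∈ negSubdifferential Φ u :=
    convex_negSubdifferential Φ hΦ u hw hm (by norm_num) (by norm_num) (by norm_num)
  have heq : ‖w‖ = ‖m‖ := le_antisymm (hmin _ hm) (hm' _ hw)
  have h1 := hmin _ hmid
  rw [← smul_add, norm_smul, Real.norm_of_nonneg (by norm_num : (0 : ℝ) ≤ 1 / 2)] at h1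
  have hp := parallelogram_law_with_norm ℝ w m
  have h0 : ‖w - m‖ = 0 := by
    nlinarith [norm_nonneg w, norm_nonneg (w - m), norm_nonneg (w + m)]
  exact sub_eq_zero.1 (norm_eq_zero.1 h0)

/-- `u : [0,∞) → H` (only the values on `[0,∞)` matter) solves `du/dt ∈ A(u)`, `u(0) = u₀`:
* `u(t) ∈ D(A)` for all `t > 0`;
* `u` has a derivative `g = du/dt ∈ L^∞(0,∞;H)`, meaning that `u` is the primitive of `g`
  (Bochner integral), and the `L^∞` norm of `g` is at most `‖A°(u₀)‖`;
* `du/dt ∈ A(u(t))` for almost every `t > 0`;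
* `u(0) = u₀`. -/
structure IsSolution (A : H → Set H) (u₀ : H) (u : ℝ → H) : Prop where
  mem_domain : ∀ t : ℝ, 0 < t → u t ∈ domain A
  deriv_mem : ∃ g : ℝ → H,
    MemLp g (⊤ : ℝ≥0∞) (volume.restrict (Ioi (0 : ℝ))) ∧
    (∀ t : ℝ, 0 ≤ t → u t = u 0 + ∫ s in (0 : ℝ)..t, g s) ∧
    eLpNorm g (⊤ : ℝ≥0∞) (volume.restrict (Ioi (0 : ℝ))) ≤ ENNReal.ofReal ‖minimalSection A u₀‖ ∧
    ∀ᵐ t ∂(volume.restrict (Ioi (0 : ℝ))), g t ∈ A (u t)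
  initial : u 0 = u₀

end Operators

/-! ### The two functionals -/

/-- The plane with its Euclidean norm and Lebesgue measure. -/
abbrev Plane : Type := EuclideanSpace ℝ (Fin 2)

/-- The real Hilbert space `L²(Ω)`. -/
abbrev L2 (Ω : Set Plane) : Type := Lp ℝ 2 (volume.restrict Ω)

/-- The classical partial derivative in the `i`-th coordinate direction. -/
def partialDeriv (i : Fin 2) (f : Plane → ℝ) (x : Plane) : ℝ :=
  fderiv ℝ f x (EuclideanSpace.single i 1)

/-- The divergence of a vector field. -/
def divergence (z : Plane → Plane) (x : Plane) : ℝ :=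
  ∑ i : Fin 2, partialDeriv i (fun y => z y i) x

/-- The vector fields `z ∈ C¹₀(Ω; ℝ²)` (compactly supported in `Ω`) with
`max (|z₁|, |z₂|) ≤ 1` everywhere. -/
def testFields (Ω : Set Plane) : Set (Plane → Plane) :=
  {z | ContDiff ℝ 1 z ∧ HasCompactSupport z ∧ tsupport z ⊆ Ω ∧ ∀ x i, |z x i| ≤ 1}

/-- The anisotropic total variation `∫_Ω (|u_{x₁}| + |u_{x₂}|)`, that is the supremum of
`∫_Ω (z, Du) = -∫_Ω u div z` over all test fields `z`. -/
def anisoTV (Ω : Set Plane) (u : L2 Ω) : EReal :=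
  ⨆ z ∈ testFields Ω, ((-∫ x in Ω, u x * divergence z x : ℝ) : EReal)

/-- `u ∈ BV(Ω)`: `u ∈ L¹(Ω)` and the total variation of `u` is finite (the anisotropic variation
is finite exactly when the isotropic one is). -/
def IsBV (Ω : Set Plane) (u : L2 Ω) : Prop :=
  MemLp u 1 (volume.restrict Ω) ∧ anisoTV Ω u < ⊤

open Classical in
/-- `Φ₀(u) = ∫_Ω (|u_{x₁}| + |u_{x₂}|)` if `u ∈ BV(Ω)`, and `+∞` otherwise. -/
def Phi0 (Ω : Set Plane) (u : L2 Ω) : EReal :=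
  if IsBV Ω u then anisoTV Ω u else ⊤

/-- `g` is the weak partial derivative of `u` in `Ω` in the `i`-th coordinate direction. -/
def IsWeakPartial (Ω : Set Plane) (i : Fin 2) (u g : L2 Ω) : Prop :=
  ∀ φ : Plane → ℝ, ContDiff ℝ ∞ φ → HasCompactSupport φ → tsupport φ ⊆ Ω →
    ∫ x in Ω, u x * partialDeriv i φ x = -∫ x in Ω, g x * φ x

/-- `u ∈ H¹(Ω)`: both weak partial derivatives exist in `L²(Ω)`. -/
def IsH1 (Ω : Set Plane) (u : L2 Ω) : Prop :=
  ∃ g : Fin 2 → L2 Ω, ∀ i, IsWeakPartial Ω i u (g i)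

open Classical in
/-- `Φ₁(u) = ∫_Ω (γ/2 |∇u|² + |u_{x₁}| + |u_{x₂}|)` if `u ∈ H¹(Ω)`, and `+∞` otherwise. The
integral has a nonnegative integrand and is taken with values in `[0, +∞]`. Weak derivatives on an
open set are unique as elements of `L²(Ω)`, so the choice is immaterial. -/
def Phi1 (Ω : Set Plane) (γ : ℝ) (u : L2 Ω) : EReal :=
  if h : IsH1 Ω u then
    ((∫⁻ x in Ω, ENNReal.ofReal
      (γ / 2 * ((h.choose 0 x) ^ 2 + (h.choose 1 x) ^ 2)
        + (|h.choose 0 x| + |h.choose 1 x|)) : ℝ≥0∞) : EReal)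
  else ⊤

/-- The functionals `Φ_i`, `i = 0, 1`. -/
def Phi (Ω : Set Plane) (γ : ℝ) : Fin 2 → L2 Ω → EReal :=
  ![Phi0 Ω, Phi1 Ω γ]

/-- The operators `A_i = -∂Φ_i`, `i = 0, 1`. -/
def opA (Ω : Set Plane) (γ : ℝ) (i : Fin 2) : L2 Ω → Set (L2 Ω) :=
  negSubdifferential (Phi Ω γ i)

/-- The functionals `Φ_i` are nonnegative. -/
theorem Phi_nonneg (Ω : Set Plane) (γ : ℝ) (i : Fin 2) (u : L2 Ω) : 0 ≤ Phi Ω γ i u := by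
  have h0 : 0 ≤ Phi0 Ω u := by
    unfold Phi0
    split_ifs
    · refine le_trans ?_ (le_iSup₂ (f := fun (z : Plane → Plane) (_ : z ∈ testFields Ω) =>
        ((-∫ x in Ω, u x * divergence z x : ℝ) : EReal)) (fun _ => 0) ?_)
      · simp [divergence, partialDeriv]
      · refine ⟨contDiff_const, HasCompactSupport.zero, ?_, ?_⟩
        · simp [tsupport]
        · simp
    · exact le_top
  have h1 : 0 ≤ Phi1 Ω γ u := by
    unfold Phi1
    split_ifs
    · exact EReal.coe_ennreal_nonneg _
    · exact le_top
  fin_cases i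
  · exact h0
  · exact h1

end AnisoFlow

end

noncomputable section

namespace AnisoFlow

open Filter

/-! ### m-dissipative operators -/

section Dissipative

variable {H : Type*} [NormedAddCommGroup H] [InnerProductSpace ℝ H]

/-! The core is the Hilbert space theory of m-dissipative operators, developed here from the
implicit Euler scheme. Let `J_r = (I - rA)⁻¹` be the resolvent and `A_r = (J_r - I)/r` the Yosida
approximation. Dissipativity makes `J_r` a contraction, and on the domain `A_r x` converges to the
least element of `A x` as `r → 0` (`minimalSection_spec`). Two Euler schemes with different steps
started at one point of the domain stay close (`norm_iterate_sub_iterate_sq_le`), so `J_h^n x`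
converges to `flow A x t` whenever `h → 0` and `n h → t`. The flow is Lipschitz in time and has the
semigroup property. An energy inequality tested against `J_r x` shows that its right derivative at
`0` is the minimal section (`tendsto_slope_flow`), and the semigroup property carries this to every
later time. Uniqueness holds because the squared distance between two solutions cannot increase.

It remains to connect this with the two functionals. By `isMDissipative_negSubdifferential`, a
nonnegative convex functional yields an m-dissipative operator once `Φ + ‖· - f‖²/(2r)` always
attains its minimum; strong convexity makes minimising sequences Cauchy, so no weak compactness is
used. For `Phi1` the minimisation runs over triples consisting of a function and its two weak
derivatives.

`Phi0` needs a detour. If `Ω` has infinite measure, `L¹` is not closed in `L²`, and the requirement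
`u ∈ L¹` can destroy lower semicontinuity. The variation `anisoTV` on all of `L²` is a supremum of
continuous linear functionals, hence well behaved, and its flow is the one constructed. Two facts
transfer the result: on `L¹ ∩ L²` both functionals have the same subdifferential
(`negSubdifferential_Phi0_eq`), and the resolvents of `anisoTV` do not increase the `L¹` norm
(`eLpNorm_one_res_anisoTV_le`), so the flow stays in a closed `L¹` ball. Both rest on the smooth
soft threshold `s - δ arctan(s/δ)`, which sends `L²` into `L¹` and does not increase the variation
(`anisoTV_shrinkLp_le`). -/

/-- A multivalued operator `A` is m-dissipative if it is dissipative and `I - rA` is onto for every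
`r > 0`. -/
structure IsMDissipative (A : H → Set H) : Prop where
  dissipative : ∀ ⦃x y a b : H⦄, a ∈ A x → b ∈ A y → ⟪a - b, x - y⟫ ≤ 0
  range : ∀ ⦃r : ℝ⦄, 0 < r → ∀ f : H, ∃ w, r⁻¹ • (w - f) ∈ A w

open Classical in
/-- The resolvent `(I - rA)⁻¹`. -/
def res (A : H → Set H) (r : ℝ) (f : H) : H :=
  if h : ∃ w, r⁻¹ • (w - f) ∈ A w then h.choose else f

/-- The Yosida approximation of `A`. -/
def yosida (A : H → Set H) (r : ℝ) (f : H) : H := r⁻¹ • (res A r f - f)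

namespace IsMDissipative

variable {A : H → Set H}

theorem yosida_mem (hA : IsMDissipative A) {r : ℝ} (hr : 0 < r) (f : H) : yosida A r f ∈ A
    (res A r f) := by
  have h := hA.range hr f
  unfold yosida res
  rw [dif_pos h]
  exact h.choose_spec

theorem res_sub_smul_yosida {r : ℝ} (hr : 0 < r) (f : H) :
    res A r f - r • yosida A r f = f := by
  rw [yosida, smul_inv_smul₀ hr.ne']
  abel

/-- On expanding the square, the cross term has the favourable sign by dissipativity. Contractivity
and uniqueness of the resolvent both follow from this. -/
theorem norm_sub_le (hA : IsMDissipative A) {r : ℝ} (hr : 0 ≤ r) {x y a b : H} (ha : a ∈ A x)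
    (hb : b ∈ A y) :
    ‖x - y‖ ≤ ‖(x - r • a) - (y - r • b)‖ := by
  have h := hA.dissipative ha hb
  have e : (x - r • a) - (y - r • b) = (x - y) - r • (a - b) := by
    rw [smul_sub]; abel
  rw [e]
  refine le_of_sq_le_sq ?_ (norm_nonneg _)
  rw [norm_sub_sq_real (x - y), real_inner_smul_right, real_inner_comm]
  nlinarith [sq_nonneg ‖r • (a - b)‖, mul_nonpos_of_nonneg_of_nonpos hr h]

theorem norm_res_sub_le (hA : IsMDissipative A) {r : ℝ} (hr : 0 < r) (f g : H) :
    ‖res A r f - res A r g‖ ≤ ‖f - g‖ := by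
  have h := hA.norm_sub_le hr.le (hA.yosida_mem hr f) (hA.yosida_mem hr g)
  rwa [res_sub_smul_yosida hr, res_sub_smul_yosida hr] at h

theorem res_sub_smul (hA : IsMDissipative A) {r : ℝ} (hr : 0 < r) {x a : H} (ha : a ∈ A x) :
    res A r (x - r • a) = x := by
  have h := hA.norm_sub_le hr.le (hA.yosida_mem hr (x - r • a)) ha
  rw [res_sub_smul_yosida hr, sub_self, norm_zero] at h
  exact sub_eq_zero.1 (norm_eq_zero.1 (le_antisymm h (norm_nonneg _)))

theorem norm_res_sub_self_le (hA : IsMDissipative A) {r : ℝ} (hr : 0 < r) {x a : H} (ha : a ∈ A x) :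
    ‖res A r x - x‖ ≤ r * ‖a‖ := by
  have h := hA.norm_res_sub_le hr x (x - r • a)
  rwa [hA.res_sub_smul hr ha, sub_sub_cancel, norm_smul, Real.norm_of_nonneg hr.le] at h

theorem norm_yosida_le (hA : IsMDissipative A) {r : ℝ} (hr : 0 < r) {x a : H} (ha : a ∈ A x) :
    ‖yosida A r x‖ ≤ ‖a‖ := by
  rw [yosida, norm_smul, norm_inv, Real.norm_of_nonneg hr.le, inv_mul_le_iff₀ hr]
  exact hA.norm_res_sub_self_le hr ha

theorem continuous_res (hA : IsMDissipative A) {r : ℝ} (hr : 0 < r) : Continuous (res A r) := by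
  refine LipschitzWith.continuous (K := 1) (LipschitzWith.of_dist_le_mul fun f g => ?_)
  simpa [dist_eq_norm] using hA.norm_res_sub_le hr f g

theorem continuous_yosida (hA : IsMDissipative A) {r : ℝ} (hr : 0 < r) : Continuous (yosida A r) :=
  ((hA.continuous_res hr).sub continuous_id).const_smul _

/-- The graph of an m-dissipative operator is closed. -/
theorem mem_of_tendsto (hA : IsMDissipative A) {ι : Type*} {l : Filter ι} [l.NeBot] {x a : ι → H}
    {x₀ a₀ : H}
    (h : ∀ᶠ n in l, a n ∈ A (x n)) (hx : Tendsto x l (𝓝 x₀)) (ha : Tendsto a l (𝓝 a₀)) :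
    a₀ ∈ A x₀ := by
  have h1 : Tendsto (fun n => res A 1 (x n - (1 : ℝ) • a n)) l
      (𝓝 (res A 1 (x₀ - (1 : ℝ) • a₀))) :=
    ((hA.continuous_res one_pos).tendsto _).comp (hx.sub (ha.const_smul _))
  have h2 : Tendsto (fun n => res A 1 (x n - (1 : ℝ) • a n)) l (𝓝 x₀) := by
    refine hx.congr' ?_
    filter_upwards [h] with n hn
    rw [hA.res_sub_smul one_pos hn]
  have h3 := tendsto_nhds_unique h1 h2
  have h4 := hA.yosida_mem one_pos (x₀ - (1 : ℝ) • a₀)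
  rw [yosida, h3] at h4
  simpa using h4

/-- With `a = A_r x` and `b = A_s x`, dissipativity reads `r‖a‖² - (r+s)⟪a,b⟫ + s‖b‖² ≤ 0`.
Cauchy–Schwarz turns this into `(‖a‖-‖b‖)(r‖a‖-s‖b‖) ≤ 0`, which forces `‖a‖ ≤ ‖b‖` since `s ≤ r`;
inserting that in the first inequality finishes. -/
theorem yosida_antitone (hA : IsMDissipative A) {r s : ℝ} (hs : 0 < s) (hsr : s ≤ r) (x : H) :
    ‖yosida A r x‖ ^ 2 ≤ ⟪yosida A r x, yosida A s x⟫ := by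
  have hr : 0 < r := hs.trans_le hsr
  have h := hA.dissipative (hA.yosida_mem hr x) (hA.yosida_mem hs x)
  have e : res A r x - res A s x = r • yosida A r x - s • yosida A s x := by
    rw [yosida, yosida, smul_inv_smul₀ hr.ne', smul_inv_smul₀ hs.ne']; abel
  rw [e] at h
  set a := yosida A r x
  set b := yosida A s x
  rcases hsr.eq_or_lt with rfl | hlt
  · have : a = b := rfl
    rw [← this, real_inner_self_eq_norm_sq]
  have h1 : ⟪a - b, r • a - s • b⟫ = r * ‖a‖ ^ 2 - (r + s) * ⟪a, b⟫ + s * ‖b‖ ^ 2 := by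
    simp only [inner_sub_left, inner_sub_right, real_inner_smul_right, real_inner_comm a b,
      real_inner_self_eq_norm_sq]
    ring
  rw [h1] at h
  have hcs : ⟪a, b⟫ ≤ ‖a‖ * ‖b‖ := real_inner_le_norm a b
  have hab : ‖a‖ ≤ ‖b‖ := by
    by_contra! hlt'
    have h2 : (‖a‖ - ‖b‖) * (r * ‖a‖ - s * ‖b‖) ≤ 0 := by
      nlinarith [mul_le_mul_of_nonneg_left hcs (add_pos hr hs).le]
    have h3 : 0 < r * ‖a‖ - s * ‖b‖ := by
      nlinarith [norm_nonneg b, mul_lt_mul_of_pos_left hlt' hr]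
    nlinarith [mul_pos (sub_pos.2 hlt') h3]
  have h4 : ‖a‖ ^ 2 ≤ ‖b‖ ^ 2 := by gcongr
  have h5 : 0 ≤ (r + s) * (⟪a, b⟫ - ‖a‖ ^ 2) := by nlinarith
  linarith [(mul_nonneg_iff_of_pos_left (add_pos hr hs)).1 h5]

theorem norm_yosida_sub_sq_le (hA : IsMDissipative A) {r s : ℝ} (hs : 0 < s) (hsr : s ≤ r) (x : H) :
    ‖yosida A r x - yosida A s x‖ ^ 2 ≤ ‖yosida A s x‖ ^ 2 - ‖yosida A r x‖ ^ 2 := by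
  rw [norm_sub_sq_real]
  linarith [hA.yosida_antitone hs hsr x]

theorem norm_yosida_antitone (hA : IsMDissipative A) {r s : ℝ} (hs : 0 < s) (hsr : s ≤ r) (x : H) :
    ‖yosida A r x‖ ≤ ‖yosida A s x‖ := by
  refine le_of_sq_le_sq ?_ (norm_nonneg _)
  linarith [hA.norm_yosida_sub_sq_le hs hsr x, sq_nonneg ‖yosida A r x - yosida A s x‖]

/-- If the Yosida approximations stay bounded at `x`, then they converge to an element
of `A x`. -/
theorem exists_tendsto_yosida [CompleteSpace H] (hA : IsMDissipative A) {x : H} {L : ℝ}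
    (hL : ∀ r : ℝ, 0 < r → ‖yosida A r x‖ ≤ L) :
    ∃ a ∈ A x, ‖a‖ ≤ L ∧ Tendsto (fun r => yosida A r x) (𝓝[>] 0) (𝓝 a) := by
  set N : ℝ → ℝ := fun r => ‖yosida A r x‖ ^ 2
  have hbdd : BddAbove (N '' Ioi 0) := by
    refine ⟨L ^ 2, ?_⟩
    rintro _ ⟨r, hr, rfl⟩
    exact pow_le_pow_left₀ (norm_nonneg _) (hL r hr) 2
  have hanti : AntitoneOn N (Ioi 0) := fun s hs r _ hsr =>
    pow_le_pow_left₀ (norm_nonneg _) (hA.norm_yosida_antitone hs hsr x) 2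
  -- The squared norms increase to a finite supremum as `r` decreases, and their differences control
  -- `‖A_r x - A_s x‖²`.
  have hcauchy : Cauchy (map (fun r => yosida A r x) (𝓝[>] (0 : ℝ))) := by
    rw [Metric.cauchy_iff]
    refine ⟨inferInstance, fun ε hε => ?_⟩
    obtain ⟨_, ⟨r₀, hr₀, rfl⟩, hlt⟩ :=
      exists_lt_of_lt_csSup (Set.Nonempty.image N ⟨1, mem_Ioi.2 one_pos⟩)
        (sub_lt_self (sSup (N '' Ioi 0)) (by positivity : 0 < ε ^ 2))
    refine ⟨(fun r => yosida A r x) '' Ioc 0 r₀, image_mem_map (Ioc_mem_nhdsGT hr₀), ?_⟩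
    have key : ∀ r s : ℝ, 0 < s → s ≤ r → r ≤ r₀ →
        dist (yosida A r x) (yosida A s x) < ε := by
      intro r s hs hsr hr
      have h1 := hA.norm_yosida_sub_sq_le hs hsr x
      have h2 : N s ≤ sSup (N '' Ioi 0) := le_csSup hbdd ⟨s, hs, rfl⟩
      have h3 : N r₀ ≤ N r := hanti (hs.trans_le hsr) hr₀ hr
      rw [dist_eq_norm]
      refine lt_of_pow_lt_pow_left₀ 2 hε.le ?_
      simp only [N] at h2 h3 hlt
      linarith
    rintro _ ⟨r, hr, rfl⟩ _ ⟨s, hs, rfl⟩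
    rcases le_total s r with h | h
    · exact key r s hs.1 h hr.2
    · rw [dist_comm]
      exact key s r hr.1 h hs.2
  obtain ⟨a, ha⟩ := CompleteSpace.complete hcauchy
  have hta : Tendsto (fun r => yosida A r x) (𝓝[>] 0) (𝓝 a) := ha
  have hid : Tendsto (fun r : ℝ => r) (𝓝[>] 0) (𝓝 0) :=
    tendsto_nhdsWithin_of_tendsto_nhds tendsto_id
  refine ⟨a, ?_, ?_, hta⟩
  · refine hA.mem_of_tendsto (x := fun r => res A r x) ?_ ?_ hta
    · filter_upwards [self_mem_nhdsWithin] with r hr using hA.yosida_mem hr x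
    · have h1 : Tendsto (fun r => x + r • yosida A r x) (𝓝[>] 0) (𝓝 (x + (0 : ℝ) • a)) :=
        tendsto_const_nhds.add (hid.smul hta)
      rw [zero_smul, add_zero] at h1
      refine h1.congr' ?_
      filter_upwards [self_mem_nhdsWithin] with r hr
      rw [yosida, smul_inv_smul₀ (ne_of_gt hr)]
      abel
  · refine le_of_tendsto hta.norm ?_
    filter_upwards [self_mem_nhdsWithin] with r hr using hL r hr

/-- On the domain the minimal section is the limit of the Yosida approximations. -/
theorem minimalSection_spec [CompleteSpace H] (hA : IsMDissipative A) {x : H} (hx : x ∈ domain A) :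
    minimalSection A x ∈ A x ∧ (∀ y ∈ A x, ‖minimalSection A x‖ ≤ ‖y‖) ∧
      Tendsto (fun r => yosida A r x) (𝓝[>] 0) (𝓝 (minimalSection A x)) := by
  have hex : ∃ w ∈ A x, ∀ y ∈ A x, ‖w‖ ≤ ‖y‖ := by
    obtain ⟨b, hb⟩ := hx
    obtain ⟨a, ha, -, hta⟩ := hA.exists_tendsto_yosida fun r hr => hA.norm_yosida_le hr hb
    refine ⟨a, ha, fun y hy => le_of_tendsto hta.norm ?_⟩
    filter_upwards [self_mem_nhdsWithin] with r hr using hA.norm_yosida_le hr hy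
  have hm : minimalSection A x ∈ A x ∧ ∀ y ∈ A x, ‖minimalSection A x‖ ≤ ‖y‖ := by
    unfold minimalSection
    rw [dif_pos hex]
    exact hex.choose_spec
  refine ⟨hm.1, hm.2, ?_⟩
  set m := minimalSection A x
  obtain ⟨a, ha, hle, hta⟩ := hA.exists_tendsto_yosida fun r hr => hA.norm_yosida_le hr hm.1
  -- Identifies `m` with the limit `a` by dissipativity alone, without convexity of the set `A x`.
  have h1 : ‖a‖ ^ 2 ≤ ⟪m, a⟫ := by
    refine le_of_tendsto_of_tendsto (hta.norm.pow 2) (tendsto_const_nhds.inner hta) ?_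
    filter_upwards [self_mem_nhdsWithin] with r (hr : 0 < r)
    have h := hA.dissipative (hA.yosida_mem hr x) hm.1
    have e : res A r x - x = r • yosida A r x := by rw [yosida, smul_inv_smul₀ hr.ne']
    rw [e, real_inner_smul_right, inner_sub_left, real_inner_self_eq_norm_sq] at h
    have := nonpos_of_mul_nonpos_right h hr
    linarith
  have h2 : ‖m - a‖ ^ 2 ≤ 0 := by
    rw [norm_sub_sq_real]
    have := pow_le_pow_left₀ (norm_nonneg _) (hm.2 a ha) 2
    linarith
  have h3 : m = a := by
    have : ‖m - a‖ = 0 := by nlinarith [norm_nonneg (m - a)]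
    exact sub_eq_zero.1 (norm_eq_zero.1 this)
  rw [h3]
  exact hta

end IsMDissipative

end Dissipative

/-! ### The semigroup generated by an m-dissipative operator -/

section Flow

variable {H : Type*} [NormedAddCommGroup H] [InnerProductSpace ℝ H]

/-- The exponential formula: the limit of the implicit Euler scheme with initial value `x`. -/
def flow (A : H → Set H) (x : H) (t : ℝ) : H :=
  haveI : Nonempty H := ⟨x⟩
  limUnder atTop fun N : ℕ => (res A (1 / ((N : ℝ) + 1)))^[⌊t * ((N : ℝ) + 1)⌋₊] x

theorem tendsto_floor_div (t : ℝ) (ht : 0 ≤ t) : Tendsto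
    (fun N : ℕ => (⌊t * ((N : ℝ) + 1)⌋₊ : ℝ) * (1 / ((N : ℝ) + 1))) atTop (𝓝 t) := by
  have h1 : Tendsto (fun N : ℕ => t - 1 / ((N : ℝ) + 1)) atTop (𝓝 (t - 0)) :=
    tendsto_const_nhds.sub tendsto_one_div_add_atTop_nhds_zero_nat
  rw [sub_zero] at h1
  refine tendsto_of_tendsto_of_tendsto_of_le_of_le h1 tendsto_const_nhds (fun N => ?_) fun N => ?_
  · have hN : (0 : ℝ) < (N : ℝ) + 1 := by positivity
    have := (Nat.lt_floor_add_one (t * ((N : ℝ) + 1))).le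
    simp only
    rw [mul_one_div, le_div_iff₀ hN, sub_mul, one_div, inv_mul_cancel₀ hN.ne']
    linarith
  · have hN : (0 : ℝ) < (N : ℝ) + 1 := by positivity
    simp only
    rw [mul_one_div, div_le_iff₀ hN]
    exact Nat.floor_le (by positivity)

namespace IsMDissipative

variable {A : H → Set H}

/-! ### Discrete estimates for the Euler iterates. -/

theorem exists_mem_iterate (hA : IsMDissipative A) {h : ℝ} (hh : 0 < h) {x a : H} (ha : a ∈ A x)
    (n : ℕ) : ∃ b ∈ A ((res A h)^[n] x), ‖b‖ ≤ ‖a‖ := by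
  induction n with
  | zero => exact ⟨a, ha, le_rfl⟩
  | succ n ih =>
    obtain ⟨b, hb, hle⟩ := ih
    rw [Function.iterate_succ_apply']
    exact ⟨_, hA.yosida_mem hh _, (hA.norm_yosida_le hh hb).trans hle⟩

theorem norm_iterate_sub_iterate_le (hA : IsMDissipative A) {h : ℝ} (hh : 0 < h) (x y : H)
    (n : ℕ) : ‖(res A h)^[n] x - (res A h)^[n] y‖ ≤ ‖x - y‖ := by
  induction n with
  | zero => exact le_rfl
  | succ n ih =>
    rw [Function.iterate_succ_apply', Function.iterate_succ_apply']
    exact (hA.norm_res_sub_le hh _ _).trans ih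

theorem norm_iterate_sub_le (hA : IsMDissipative A) {h : ℝ} (hh : 0 < h) {x a : H}
    (ha : a ∈ A x) (n : ℕ) : ‖(res A h)^[n] x - x‖ ≤ n * h * ‖a‖ := by
  induction n with
  | zero => simp
  | succ n ih =>
    obtain ⟨b, hb, hle⟩ := hA.exists_mem_iterate hh ha n
    rw [Function.iterate_succ_apply']
    have h1 := norm_sub_le_norm_sub_add_norm_sub (res A h ((res A h)^[n] x)) ((res A h)^[n] x) x
    have h2 := hA.norm_res_sub_self_le hh hb
    have h3 := mul_le_mul_of_nonneg_left hle hh.le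
    push_cast
    linarith

/-- With `d` the difference of the resolvents, the two vectors on the right are `d - h A_h x` and `d
+ k A_k y`. Weighting by `k` and `h` combines the cross terms into `-2hk⟪d, A_h x - A_k y⟫ ≥ 0`. -/
theorem norm_res_sub_res_sq_le (hA : IsMDissipative A) {h k : ℝ} (hh : 0 < h) (hk : 0 < k)
    (x y : H) : (h + k) * ‖res A h x - res A k y‖ ^ 2 ≤
      k * ‖x - res A k y‖ ^ 2 + h * ‖res A h x - y‖ ^ 2 := by
  have h1 := hA.dissipative (hA.yosida_mem hh x) (hA.yosida_mem hk y)
  have e1 := res_sub_smul_yosida (A := A) hh x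
  have e2 := res_sub_smul_yosida (A := A) hk y
  set a := yosida A h x
  set b := yosida A k y
  set d := res A h x - res A k y with hd
  have ep : x - res A k y = d - h • a := by
    calc x - res A k y = (res A h x - h • a) - res A k y := by rw [e1]
      _ = d - h • a := by rw [hd]; abel
  have eq : res A h x - y = d + k • b := by
    calc res A h x - y = res A h x - (res A k y - k • b) := by rw [e2]
      _ = d + k • b := by rw [hd]; abel
  clear_value d a b
  rw [ep, eq, norm_sub_sq_real, norm_add_sq_real, real_inner_smul_right, real_inner_smul_right]
  rw [inner_sub_left, real_inner_comm, real_inner_comm d b] at h1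
  nlinarith [mul_nonpos_of_nonneg_of_nonpos (mul_pos hh hk).le h1,
    mul_nonneg hk.le (sq_nonneg ‖h • a‖), mul_nonneg hh.le (sq_nonneg ‖k • b‖)]

/-- Comparison of two implicit Euler schemes with the same initial value. -/
theorem norm_iterate_sub_iterate_sq_le (hA : IsMDissipative A) {h k : ℝ} (hh : 0 < h)
    (hk : 0 < k) {x a : H} (ha : a ∈ A x) (m n : ℕ) :
    ‖(res A h)^[m] x - (res A k)^[n] x‖ ^ 2 ≤
      ‖a‖ ^ 2 * ((m * h - n * k) ^ 2 + m * h * h + n * k * k) := by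
  induction m generalizing n with
  | zero =>
    have h1 := pow_le_pow_left₀ (norm_nonneg _) (hA.norm_iterate_sub_le hk ha n) 2
    rw [norm_sub_rev] at h1
    simp only [Function.iterate_zero, id, Nat.cast_zero]
    have h2 : 0 ≤ ‖a‖ ^ 2 * (n * k * k) := by positivity
    nlinarith
  | succ m ihm =>
    induction n with
    | zero =>
      have h1 := pow_le_pow_left₀ (norm_nonneg _) (hA.norm_iterate_sub_le hh ha (m + 1)) 2
      simp only [Function.iterate_zero, id, Nat.cast_zero]
      have h2 : 0 ≤ ‖a‖ ^ 2 * (((m + 1 : ℕ) : ℝ) * h * h) := by positivity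
      nlinarith
    | succ n ihn =>
      have h1 := hA.norm_res_sub_res_sq_le hh hk ((res A h)^[m] x) ((res A k)^[n] x)
      have h2 := ihm (n + 1)
      rw [Function.iterate_succ_apply' _ n] at h2
      have h3 := ihn
      rw [Function.iterate_succ_apply' _ m] at h3
      rw [Function.iterate_succ_apply', Function.iterate_succ_apply']
      push_cast at h2 h3 ⊢
      have h4 := mul_le_mul_of_nonneg_left h2 hk.le
      have h5 := mul_le_mul_of_nonneg_left h3 hh.le
      -- The bound `(mh-nk)² + mh² + nk²` satisfies the recursion with equality, which is why `ring`
      -- closes the step.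
      refine le_of_mul_le_mul_left ((h1.trans (add_le_add h4 h5)).trans (le_of_eq ?_))
        (add_pos hh hk)
      ring

/-- Each Euler step changes `‖· - y‖²` by at most `2h⟪b, x_{n+1} - y⟫`; replacing `x_{n+1}` by `x`
costs at most `‖b‖ (n+1)h‖a‖` in the inner product. -/
theorem norm_iterate_sub_sq_le (hA : IsMDissipative A) {h : ℝ} (hh : 0 < h) {x a y b : H}
    (ha : a ∈ A x) (hb : b ∈ A y) (n : ℕ) :
    ‖(res A h)^[n] x - y‖ ^ 2 ≤
      ‖x - y‖ ^ 2 + 2 * (n * h * ⟪b, x - y⟫ + ‖b‖ * ‖a‖ * (n * h) ^ 2) := by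
  induction n with
  | zero => simp
  | succ n ih =>
    have h1 := hA.norm_iterate_sub_le hh ha (n + 1)
    rw [Function.iterate_succ_apply'] at h1 ⊢
    have h2 := hA.dissipative (hA.yosida_mem hh ((res A h)^[n] x)) hb
    have e := res_sub_smul_yosida (A := A) hh ((res A h)^[n] x)
    set p := (res A h)^[n] x
    set q := res A h p
    set c := yosida A h p
    have h3 : ‖p - y‖ ^ 2 = ‖q - y‖ ^ 2 - 2 * (h * ⟪q - y, c⟫) + ‖h • c‖ ^ 2 := by
      rw [← real_inner_smul_right, ← norm_sub_sq_real, ← e]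
      abel_nf
    rw [inner_sub_left, real_inner_comm] at h2
    have h4 : ⟪b, q - y⟫ = ⟪b, q - x⟫ + ⟪b, x - y⟫ := by
      rw [← inner_add_right, sub_add_sub_cancel]
    have h5 : ⟪b, q - x⟫ ≤ ‖b‖ * ((n + 1) * h * ‖a‖) := by
      refine (real_inner_le_norm _ _).trans (mul_le_mul_of_nonneg_left ?_ (norm_nonneg _))
      exact_mod_cast h1
    have h6 := mul_le_mul_of_nonneg_left (h2.trans_eq rfl) hh.le
    have h7 := mul_le_mul_of_nonneg_left h5 hh.le
    -- The slack in the quadratic term: `(n+1)² - n²` exceeds the required `n+1` by `n`.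
    have h8 : 0 ≤ ‖b‖ * ‖a‖ * (n * h ^ 2) := by positivity
    push_cast
    nlinarith [sq_nonneg ‖h • c‖]

variable [CompleteSpace H]

/-! ### The limit of the scheme and its properties. -/

theorem tendsto_flow_aux (hA : IsMDissipative A) {x : H} (hx : x ∈ domain A) {t : ℝ}
    (ht : 0 ≤ t) : Tendsto
      (fun N : ℕ => (res A (1 / ((N : ℝ) + 1)))^[⌊t * ((N : ℝ) + 1)⌋₊] x) atTop
      (𝓝 (flow A x t)) := by
  obtain ⟨a, ha⟩ := hx
  have hc : CauchySeq
      (fun N : ℕ => (res A (1 / ((N : ℝ) + 1)))^[⌊t * ((N : ℝ) + 1)⌋₊] x) := by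
    rw [cauchySeq_iff_tendsto_dist_atTop_0]
    have h1 := tendsto_floor_div t ht
    have h0 : Tendsto (fun N : ℕ => 1 / ((N : ℝ) + 1)) atTop (𝓝 0) :=
      tendsto_one_div_add_atTop_nhds_zero_nat
    have hf : Tendsto (Prod.fst : ℕ × ℕ → ℕ) atTop atTop := by
      rw [← prod_atTop_atTop_eq]; exact tendsto_fst
    have hs : Tendsto (Prod.snd : ℕ × ℕ → ℕ) atTop atTop := by
      rw [← prod_atTop_atTop_eq]; exact tendsto_snd
    have h2 := ((((h1.comp hf).sub (h1.comp hs)).pow 2).add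
      ((h1.comp hf).mul (h0.comp hf))).add ((h1.comp hs).mul (h0.comp hs))
    have h3 := (h2.const_mul (‖a‖ ^ 2)).sqrt
    simp only [sub_self, mul_zero, add_zero, ne_eq, OfNat.ofNat_ne_zero, not_false_eq_true,
      zero_pow, Real.sqrt_zero] at h3
    refine squeeze_zero (fun _ => dist_nonneg) (fun p => ?_) h3
    rw [dist_eq_norm]
    refine Real.le_sqrt_of_sq_le ?_
    exact hA.norm_iterate_sub_iterate_sq_le (by positivity) (by positivity) ha _ _
  exact hc.tendsto_limUnder

/-- Every implicit Euler scheme converges to the flow. -/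
theorem tendsto_flow (hA : IsMDissipative A) {x : H} (hx : x ∈ domain A) {t : ℝ} (ht : 0 ≤ t)
    {h : ℕ → ℝ} {m : ℕ → ℕ} (hpos : ∀ N, 0 < h N) (h0 : Tendsto h atTop (𝓝 0))
    (hm : Tendsto (fun N => m N * h N) atTop (𝓝 t)) :
    Tendsto (fun N => (res A (h N))^[m N] x) atTop (𝓝 (flow A x t)) := by
  obtain ⟨a, ha⟩ := id hx
  have h1 := tendsto_floor_div t ht
  have h0' : Tendsto (fun N : ℕ => 1 / ((N : ℝ) + 1)) atTop (𝓝 0) :=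
    tendsto_one_div_add_atTop_nhds_zero_nat
  have h2 := (((hm.sub h1).pow 2).add (hm.mul h0)).add (h1.mul h0')
  have h3 := (h2.const_mul (‖a‖ ^ 2)).sqrt
  simp only [sub_self, mul_zero, add_zero, ne_eq, OfNat.ofNat_ne_zero, not_false_eq_true,
    zero_pow, Real.sqrt_zero] at h3
  have h4 : Tendsto (fun N : ℕ => (res A (h N))^[m N] x -
      (res A (1 / ((N : ℝ) + 1)))^[⌊t * ((N : ℝ) + 1)⌋₊] x) atTop (𝓝 0) := by
    refine squeeze_zero_norm (fun N => ?_) h3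
    refine Real.le_sqrt_of_sq_le ?_
    exact hA.norm_iterate_sub_iterate_sq_le (hpos N) (by positivity) ha _ _
  have h5 := h4.add (hA.tendsto_flow_aux hx ht)
  simpa using h5

theorem flow_zero (hA : IsMDissipative A) {x : H} (hx : x ∈ domain A) : flow A x 0 = x := by
  have h := hA.tendsto_flow hx le_rfl (h := fun N : ℕ => 1 / ((N : ℝ) + 1)) (m := fun _ => 0)
    (fun _ => by positivity) tendsto_one_div_add_atTop_nhds_zero_nat (by simp)
  exact tendsto_nhds_unique h tendsto_const_nhds

theorem norm_flow_sub_self_le (hA : IsMDissipative A) {x a : H} (ha : a ∈ A x) {t : ℝ}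
    (ht : 0 ≤ t) : ‖flow A x t - x‖ ≤ t * ‖a‖ := by
  refine le_of_tendsto_of_tendsto
    (((hA.tendsto_flow_aux ⟨a, ha⟩ ht).sub tendsto_const_nhds).norm)
    ((tendsto_floor_div t ht).mul_const ‖a‖) (Eventually.of_forall fun N => ?_)
  exact hA.norm_iterate_sub_le (by positivity) ha _

theorem flow_mem_of_isClosed (hA : IsMDissipative A) {K : Set H} (hK : IsClosed K)
    (hres : ∀ r : ℝ, 0 < r → MapsTo (res A r) K K) {x : H} (hx : x ∈ domain A) (hxK : x ∈ K)
    {t : ℝ} (ht : 0 ≤ t) : flow A x t ∈ K :=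
  hK.mem_of_tendsto (hA.tendsto_flow_aux hx ht)
    (Eventually.of_forall fun _ => (hres _ (by positivity)).iterate _ hxK)

/-- The Yosida approximations along the Euler iterates are bounded by `‖a‖`. For fixed `r` the bound
passes to the limit by continuity, and `exists_tendsto_yosida` then supplies an element of `A` at
the limit. -/
theorem exists_mem_flow (hA : IsMDissipative A) {x a : H} (ha : a ∈ A x) {t : ℝ}
    (ht : 0 ≤ t) : ∃ b ∈ A (flow A x t), ‖b‖ ≤ ‖a‖ := by
  obtain ⟨b, hb, hle, -⟩ := hA.exists_tendsto_yosida (x := flow A x t) (L := ‖a‖) fun r hr => by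
    refine le_of_tendsto
      (((hA.continuous_yosida hr).tendsto _).comp (hA.tendsto_flow_aux ⟨a, ha⟩ ht)).norm
      (Eventually.of_forall fun N => ?_)
    obtain ⟨b, hb, hle⟩ := hA.exists_mem_iterate (h := 1 / ((N : ℝ) + 1)) (by positivity) ha
      ⌊t * ((N : ℝ) + 1)⌋₊
    exact (hA.norm_yosida_le hr hb).trans hle
  exact ⟨b, hb, hle⟩

theorem flow_mem_domain (hA : IsMDissipative A) {x : H} (hx : x ∈ domain A) {t : ℝ}
    (ht : 0 ≤ t) : flow A x t ∈ domain A := by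
  obtain ⟨a, ha⟩ := hx
  obtain ⟨b, hb, -⟩ := hA.exists_mem_flow ha ht
  exact ⟨b, hb⟩

theorem norm_minimalSection_flow_le (hA : IsMDissipative A) {x : H} (hx : x ∈ domain A) {t : ℝ}
    (ht : 0 ≤ t) : ‖minimalSection A (flow A x t)‖ ≤ ‖minimalSection A x‖ := by
  obtain ⟨b, hb, hle⟩ := hA.exists_mem_flow (hA.minimalSection_spec hx).1 ht
  exact ((hA.minimalSection_spec ⟨b, hb⟩).2.1 b hb).trans hle

/-- The semigroup property. -/
theorem flow_add (hA : IsMDissipative A) {x : H} (hx : x ∈ domain A) {s t : ℝ}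
    (hs : 0 ≤ s) (ht : 0 ≤ t) : flow A x (s + t) = flow A (flow A x s) t := by
  have h0 : Tendsto (fun N : ℕ => 1 / ((N : ℝ) + 1)) atTop (𝓝 0) :=
    tendsto_one_div_add_atTop_nhds_zero_nat
  -- The sum of the two floors need not be the floor of the sum, so convergence for arbitrary step
  -- counts is required.
  have h1 := hA.tendsto_flow hx (add_nonneg hs ht) (h := fun N : ℕ => 1 / ((N : ℝ) + 1))
    (m := fun N => ⌊t * ((N : ℝ) + 1)⌋₊ + ⌊s * ((N : ℝ) + 1)⌋₊) (fun _ => by positivity) h0 (by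
      have := (tendsto_floor_div t ht).add (tendsto_floor_div s hs)
      rw [add_comm s]
      refine this.congr fun N => ?_
      push_cast
      ring)
  have h2 := hA.tendsto_flow_aux (hA.flow_mem_domain hx hs) ht
  have h3 := hA.tendsto_flow_aux hx hs
  refine tendsto_nhds_unique h1 ?_
  have h4 : Tendsto (fun N : ℕ =>
      (res A (1 / ((N : ℝ) + 1)))^[⌊t * ((N : ℝ) + 1)⌋₊ + ⌊s * ((N : ℝ) + 1)⌋₊] x -
      (res A (1 / ((N : ℝ) + 1)))^[⌊t * ((N : ℝ) + 1)⌋₊] (flow A x s)) atTop (𝓝 0) := by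
    have h5 := (h3.sub (tendsto_const_nhds (x := flow A x s))).norm
    rw [sub_self, norm_zero] at h5
    refine squeeze_zero_norm (fun N => ?_) h5
    rw [Function.iterate_add_apply]
    exact hA.norm_iterate_sub_iterate_le (by positivity) _ _ _
  simpa using h4.add h2

theorem norm_flow_sub_flow_le (hA : IsMDissipative A) {x : H} (hx : x ∈ domain A) {s t : ℝ}
    (hs : 0 ≤ s) (hst : s ≤ t) :
    ‖flow A x t - flow A x s‖ ≤ (t - s) * ‖minimalSection A (flow A x s)‖ := by
  have h := hA.flow_add hx hs (sub_nonneg.2 hst)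
  rw [add_sub_cancel] at h
  rw [h]
  exact hA.norm_flow_sub_self_le (hA.minimalSection_spec (hA.flow_mem_domain hx hs)).1
    (sub_nonneg.2 hst)

/-- Limit of the discrete inequality `norm_iterate_sub_sq_le`, after dropping `‖flow A x t - x‖²`.
-/
theorem inner_flow_sub_le (hA : IsMDissipative A) {x a y b : H} (ha : a ∈ A x) (hb : b ∈ A y)
    {t : ℝ} (ht : 0 ≤ t) :
    ⟪flow A x t - x, x - y⟫ ≤ t * ⟪b, x - y⟫ + ‖b‖ * ‖a‖ * t ^ 2 := by
  have h1 : ‖flow A x t - y‖ ^ 2 ≤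
      ‖x - y‖ ^ 2 + 2 * (t * ⟪b, x - y⟫ + ‖b‖ * ‖a‖ * t ^ 2) := by
    have hf := tendsto_floor_div t ht
    refine le_of_tendsto_of_tendsto
      (((hA.tendsto_flow_aux ⟨a, ha⟩ ht).sub tendsto_const_nhds).norm.pow 2)
      ((((hf.mul_const _).add ((hf.pow 2).const_mul _)).const_mul 2).const_add _)
      (Eventually.of_forall fun N => ?_)
    exact hA.norm_iterate_sub_sq_le (by positivity) ha hb _
  have e : flow A x t - y = (flow A x t - x) + (x - y) := by abel
  rw [e, norm_add_sq_real] at h1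
  nlinarith [sq_nonneg ‖flow A x t - x‖]

/-- The flow is right differentiable at `0`, with derivative the minimal section. -/
theorem tendsto_slope_flow (hA : IsMDissipative A) {x : H} (hx : x ∈ domain A) :
    Tendsto (fun t : ℝ => t⁻¹ • (flow A x t - x)) (𝓝[>] 0) (𝓝 (minimalSection A x)) := by
  obtain ⟨hm, -, hlim⟩ := hA.minimalSection_spec hx
  set a := minimalSection A x
  have key : ∀ t r : ℝ, 0 < t → 0 < r →
      ‖t⁻¹ • (flow A x t - x) - yosida A r x‖ ^ 2 ≤
        ‖a‖ ^ 2 - ‖yosida A r x‖ ^ 2 + 2 * (‖a‖ ^ 2 * t / r) := by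
    intro t r ht hr
    -- The comparison point is `J_r x`, so that `x - J_r x = -r A_r x` and the inequality bounds
    -- `⟪flow A x t - x, A_r x⟫` from below.
    have h1 := hA.inner_flow_sub_le hm (hA.yosida_mem hr x) ht.le
    have h2 := hA.norm_flow_sub_self_le hm ht.le
    have h3 := hA.norm_yosida_le hr hm
    have e : x - res A r x = -(r • yosida A r x) := by rw [yosida, smul_inv_smul₀ hr.ne']; abel
    set b := yosida A r x
    rw [e, inner_neg_right, inner_neg_right, real_inner_smul_right, real_inner_smul_right,
      real_inner_self_eq_norm_sq] at h1
    set d := flow A x t - x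
    have h4 : ‖t⁻¹ • d‖ ≤ ‖a‖ := by
      rwa [norm_smul, norm_inv, Real.norm_of_nonneg ht.le, inv_mul_le_iff₀ ht]
    have h5 := pow_le_pow_left₀ (norm_nonneg _) h4 2
    have h6 : ‖b‖ * ‖a‖ ≤ ‖a‖ ^ 2 := by nlinarith [norm_nonneg a]
    have h7 : ‖b‖ ^ 2 - ‖a‖ ^ 2 * t / r ≤ t⁻¹ * ⟪d, b⟫ := by
      rw [← div_eq_inv_mul, le_div_iff₀ ht]
      have h8 : r * ((‖b‖ ^ 2 - ‖a‖ ^ 2 * t / r) * t) ≤ r * ⟪d, b⟫ := by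
        have : r * ((‖b‖ ^ 2 - ‖a‖ ^ 2 * t / r) * t) = t * (r * ‖b‖ ^ 2) - ‖a‖ ^ 2 * t ^ 2 := by
          field_simp
        rw [this]
        nlinarith [mul_le_mul_of_nonneg_right h6 (sq_nonneg t)]
      exact le_of_mul_le_mul_left h8 hr
    rw [norm_sub_sq_real, real_inner_smul_left]
    linarith
  rw [Metric.tendsto_nhds]
  intro ε hε
  -- First `r` is fixed small, then `t` is sent to `0`: the error term in `key` contains `t / r`.
  have hev : ∀ᶠ r in 𝓝[>] (0 : ℝ), ‖a‖ ^ 2 - ‖yosida A r x‖ ^ 2 < (ε / 2) ^ 2 / 2 ∧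
      ‖yosida A r x - a‖ < ε / 2 := by
    have h1 := (hlim.norm.pow 2).const_sub (‖a‖ ^ 2)
    rw [sub_self] at h1
    have h2 := (hlim.sub_const a).norm
    rw [sub_self, norm_zero] at h2
    exact (h1.eventually_lt_const (by positivity)).and (h2.eventually_lt_const (by positivity))
  obtain ⟨r, ⟨hr1, hr2⟩, hr⟩ := (hev.and self_mem_nhdsWithin).exists
  have hr : 0 < r := hr
  have hev2 : ∀ᶠ t in 𝓝[>] (0 : ℝ), 2 * (‖a‖ ^ 2 * t / r) < (ε / 2) ^ 2 / 2 := by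
    have h1 : Tendsto (fun t : ℝ => 2 * (‖a‖ ^ 2 * t / r)) (𝓝 0) (𝓝 (2 * (‖a‖ ^ 2 * 0 / r))) :=
      Continuous.tendsto (by fun_prop) 0
    refine (tendsto_nhdsWithin_of_tendsto_nhds h1).eventually_lt_const ?_
    simp only [mul_zero, zero_div]
    positivity
  filter_upwards [hev2, self_mem_nhdsWithin] with t ht1 ht
  have h1 := key t r ht hr
  have h2 : ‖t⁻¹ • (flow A x t - x) - yosida A r x‖ < ε / 2 := by
    refine lt_of_pow_lt_pow_left₀ 2 (by positivity) ?_
    linarith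
  rw [dist_eq_norm]
  have := norm_sub_le_norm_sub_add_norm_sub (t⁻¹ • (flow A x t - x)) (yosida A r x) a
  linarith

theorem hasDerivWithinAt_flow (hA : IsMDissipative A) {x : H} (hx : x ∈ domain A) {t : ℝ}
    (ht : 0 ≤ t) :
    HasDerivWithinAt (flow A x) (minimalSection A (flow A x t)) (Ici t) t := by
  rw [← hasDerivWithinAt_Ioi_iff_Ici, hasDerivWithinAt_iff_tendsto_slope' self_notMem_Ioi]
  have h1 := hA.tendsto_slope_flow (hA.flow_mem_domain hx ht)
  have h2 : Tendsto (fun s : ℝ => s - t) (𝓝[>] t) (𝓝[>] 0) := by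
    refine tendsto_nhdsWithin_iff.2 ⟨?_, ?_⟩
    · have : Tendsto (fun s : ℝ => s - t) (𝓝 t) (𝓝 (t - t)) := Continuous.tendsto (by fun_prop) t
      rw [sub_self] at this
      exact tendsto_nhdsWithin_of_tendsto_nhds this
    · filter_upwards [self_mem_nhdsWithin] with s hs using mem_Ioi.2 (sub_pos.2 (mem_Ioi.1 hs))
  refine (h1.comp h2).congr' ?_
  filter_upwards [self_mem_nhdsWithin] with s (hs : t < s)
  have h3 := hA.flow_add hx ht (sub_nonneg.2 hs.le)
  rw [add_sub_cancel] at h3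
  simp only [Function.comp, slope_def_module, ← h3]

end IsMDissipative

end Flow

/-! ### Existence and uniqueness of solutions -/

section Solutions

theorem intervalIntegrable_of_memLp_top {E : Type*} [NormedAddCommGroup E] {g : ℝ → E}
    (hg : MemLp g ⊤ (volume.restrict (Ioi (0 : ℝ)))) {a b : ℝ} (ha : 0 ≤ a) (hab : a ≤ b) :
    IntervalIntegrable g volume a b := by
  rw [intervalIntegrable_iff_integrableOn_Ioc_of_le hab]
  have h1 : Ioc a b ⊆ Ioi 0 := fun s hs => lt_of_le_of_lt ha hs.1
  have h2 : MemLp g ⊤ (volume.restrict (Ioc a b)) :=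
    hg.mono_measure (Measure.restrict_mono h1 le_rfl)
  exact (h2.mono_exponent le_top).integrable (q := 1) le_rfl

theorem minimalSection_congr {E : Type*} [NormedAddCommGroup E] {A B : E → Set E} {x : E}
    (h : A x = B x) :
    minimalSection A x = minimalSection B x := by
  unfold minimalSection
  generalize A x = S at h ⊢
  subst h
  rfl

variable {H : Type*} [NormedAddCommGroup H] [InnerProductSpace ℝ H]

/-- Cutting `[0,t]` into `N+1` equal pieces bounds the total increase by `K t²/(N+1)`. -/
theorem le_of_sub_le_mul_sq {f : ℝ → ℝ} {K : ℝ}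
    (hf : ∀ a b : ℝ, 0 ≤ a → a ≤ b → f b - f a ≤ K * (b - a) ^ 2) {t : ℝ} (ht : 0 ≤ t) :
    f t ≤ f 0 := by
  have key : ∀ N : ℕ, f t - f 0 ≤ K * t ^ 2 * (1 / ((N : ℝ) + 1)) := by
    intro N
    have hN : (0 : ℝ) < (N : ℝ) + 1 := by positivity
    have ind : ∀ k : ℕ, f (k * (t / (N + 1))) - f 0 ≤ k * (K * (t / (N + 1)) ^ 2) := by
      intro k
      induction k with
      | zero => simp
      | succ k ih =>
        have h0 : 0 ≤ t / ((N : ℝ) + 1) := by positivity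
        have h1 := hf (k * (t / (N + 1))) ((k + 1 : ℕ) * (t / (N + 1))) (by positivity) (by
          push_cast; nlinarith)
        have e : ((k + 1 : ℕ) : ℝ) * (t / (N + 1)) - k * (t / (N + 1)) = t / (N + 1) := by
          push_cast; ring
        rw [e] at h1
        push_cast at h1 ⊢
        linarith
    have h2 := ind (N + 1)
    push_cast at h2
    have e1 : ((N : ℝ) + 1) * (t / (N + 1)) = t := by field_simp
    have e2 : ((N : ℝ) + 1) * (K * (t / (N + 1)) ^ 2) = K * t ^ 2 * (1 / ((N : ℝ) + 1)) := by
      field_simp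
    rwa [e1, e2] at h2
  have h3 : Tendsto (fun N : ℕ => K * t ^ 2 * (1 / ((N : ℝ) + 1))) atTop (𝓝 (K * t ^ 2 * 0)) :=
    tendsto_one_div_add_atTop_nhds_zero_nat.const_mul _
  rw [mul_zero] at h3
  linarith [ge_of_tendsto' h3 key]

/-- The difference `w` is a Lipschitz primitive of `G`, and `⟪G, w⟫ ≤ 0` almost everywhere. A
quadratic bound on the increments of `‖w‖²` replaces almost everywhere differentiation of the
Bochner integral. -/
theorem IsSolution.unique [CompleteSpace H] {A : H → Set H}
    (hA : ∀ ⦃x y a b : H⦄, a ∈ A x → b ∈ A y → ⟪a - b, x - y⟫ ≤ 0) {u₀ : H} {u v : ℝ → H}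
    (hu : IsSolution A u₀ u) (hv : IsSolution A u₀ v) {t : ℝ} (ht : 0 ≤ t) : u t = v t := by
  obtain ⟨g, hg, hgi, -, hgA⟩ := hu.deriv_mem
  obtain ⟨k, hk, hki, -, hkA⟩ := hv.deriv_mem
  set G : ℝ → H := fun s => g s - k s
  set w : ℝ → H := fun s => u s - v s
  have hG : MemLp G ⊤ (volume.restrict (Ioi (0 : ℝ))) := hg.sub hk
  set C : ℝ := (eLpNorm G ⊤ (volume.restrict (Ioi (0 : ℝ)))).toReal
  have hC : ∀ᵐ s ∂(volume.restrict (Ioi (0 : ℝ))), ‖G s‖ ≤ C := by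
    have h1 := ae_le_eLpNormEssSup (f := G) (μ := volume.restrict (Ioi (0 : ℝ)))
    filter_upwards [h1] with s hs
    rw [← eLpNorm_exponent_top] at hs
    have := ENNReal.toReal_mono hG.2.ne hs
    rwa [toReal_enorm] at this
  have hdiff : ∀ a b : ℝ, 0 ≤ a → a ≤ b → w b - w a = ∫ s in a..b, G s := by
    intro a b ha hab
    have e1 := intervalIntegral.integral_add_adjacent_intervals
      (intervalIntegrable_of_memLp_top hg le_rfl ha) (intervalIntegrable_of_memLp_top hg ha hab)
    have e2 := intervalIntegral.integral_add_adjacent_intervals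
      (intervalIntegrable_of_memLp_top hk le_rfl ha) (intervalIntegrable_of_memLp_top hk ha hab)
    rw [intervalIntegral.integral_sub (intervalIntegrable_of_memLp_top hg ha hab)
      (intervalIntegrable_of_memLp_top hk ha hab)]
    simp only [w]
    rw [hgi b (ha.trans hab), hgi a ha, hki b (ha.trans hab), hki a ha, ← e1, ← e2]
    abel
  have hae : ∀ a b : ℝ, 0 ≤ a → ∀ᵐ s ∂volume, s ∈ Ioc a b →
      ‖G s‖ ≤ C ∧ ⟪G s, w s⟫ ≤ 0 := by
    intro a b ha
    have h1 : ∀ᵐ s ∂(volume.restrict (Ioi (0 : ℝ))), ‖G s‖ ≤ C ∧ ⟪G s, w s⟫ ≤ 0 := by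
      filter_upwards [hC, hgA, hkA] with s h1 h2 h3 using ⟨h1, hA h2 h3⟩
    rw [ae_restrict_iff' measurableSet_Ioi] at h1
    filter_upwards [h1] with s hs hs' using hs (lt_of_le_of_lt ha hs'.1)
  have hC0 : 0 ≤ C := ENNReal.toReal_nonneg
  have hlip : ∀ a b : ℝ, 0 ≤ a → a ≤ b → ‖w b - w a‖ ≤ C * (b - a) := by
    intro a b ha hab
    rw [hdiff a b ha hab]
    have h1 := intervalIntegral.norm_integral_le_of_norm_le_const_ae (a := a) (b := b) (f := G)
      (C := C) (by
        rw [uIoc_of_le hab]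
        filter_upwards [hae a b ha] with s hs hs' using (hs hs').1)
    rwa [abs_of_nonneg (sub_nonneg.2 hab)] at h1
  have hsq : ∀ a b : ℝ, 0 ≤ a → a ≤ b → ‖w b‖ ^ 2 - ‖w a‖ ^ 2 ≤ 2 * C ^ 2 * (b - a) ^ 2 := by
    intro a b ha hab
    have hGi := intervalIntegrable_of_memLp_top hG ha hab
    have e1 : ‖w b‖ ^ 2 - ‖w a‖ ^ 2 = ⟪w b + w a, w b - w a⟫ := by
      rw [inner_sub_right, inner_add_left, inner_add_left, real_inner_self_eq_norm_sq,
        real_inner_self_eq_norm_sq, real_inner_comm (w a) (w b)]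
      ring
    have e2 : ⟪w b + w a, ∫ s in a..b, G s⟫ = ∫ s in a..b, ⟪w b + w a, G s⟫ :=
      ((innerSL ℝ (w b + w a)).intervalIntegral_comp_comm hGi).symm
    have hi : IntervalIntegrable (fun s => ⟪w b + w a, G s⟫) volume a b :=
      (innerSL ℝ (w b + w a)).integrable_comp hGi.1 |> fun h1 =>
        ⟨h1, (innerSL ℝ (w b + w a)).integrable_comp hGi.2⟩
    rw [e1, hdiff a b ha hab, e2]
    have h3 : ∫ s in a..b, ⟪w b + w a, G s⟫ ≤ ∫ _ in a..b, 2 * C ^ 2 * (b - a) := by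
      rw [intervalIntegral.integral_of_le hab, intervalIntegral.integral_of_le hab]
      refine setIntegral_mono_ae_restrict hi.1 intervalIntegrable_const.1 ?_
      rw [Filter.EventuallyLE, ae_restrict_iff' measurableSet_Ioc]
      filter_upwards [hae a b ha] with s hs hsI
      obtain ⟨h4, h5⟩ := hs hsI
      -- Replacing `w b + w a` by `2 w s` makes the dissipative term appear; the Lipschitz bound
      -- leaves an error of order `b - a`.
      have e3 : ⟪w b + w a, G s⟫ = 2 * ⟪G s, w s⟫ + ⟪(w b - w s) - (w s - w a), G s⟫ := by
        have : w b + w a = (2 : ℝ) • w s + ((w b - w s) - (w s - w a)) := by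
          rw [two_smul]; abel
        rw [this, inner_add_left, real_inner_smul_left, real_inner_comm (G s)]
      have h6 : ‖(w b - w s) - (w s - w a)‖ ≤ C * (b - a) := by
        have h7 := hlip s b (ha.trans hsI.1.le) hsI.2
        have h8 := hlip a s ha hsI.1.le
        have h9 := norm_sub_le (w b - w s) (w s - w a)
        linarith
      have h10 := (real_inner_le_norm ((w b - w s) - (w s - w a)) (G s)).trans
        (mul_le_mul h6 h4 (norm_nonneg _) (mul_nonneg hC0 (sub_nonneg.2 hab)))
      have h11 : 0 ≤ C ^ 2 * (b - a) := mul_nonneg (sq_nonneg _) (sub_nonneg.2 hab)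
      rw [e3]
      nlinarith
    refine h3.trans (le_of_eq ?_)
    rw [intervalIntegral.integral_const, smul_eq_mul]
    ring
  have h1 := le_of_sub_le_mul_sq (f := fun s => ‖w s‖ ^ 2) hsq ht
  have h2 : w 0 = 0 := by simp only [w]; rw [hu.initial, hv.initial, sub_self]
  simp only [h2, norm_zero, ne_eq, OfNat.ofNat_ne_zero, not_false_eq_true, zero_pow] at h1
  have h3 : ‖w t‖ = 0 := by nlinarith [norm_nonneg (w t)]
  exact sub_eq_zero.1 (norm_eq_zero.1 h3)

namespace IsMDissipative

variable [CompleteSpace H]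

theorem continuousOn_flow {A : H → Set H} (hA : IsMDissipative A) {x : H} (hx : x ∈ domain A) :
    ContinuousOn (flow A x) (Ici 0) := by
  have key : ∀ s t : ℝ, 0 ≤ s → s ≤ t →
      dist (flow A x t) (flow A x s) ≤ ‖minimalSection A x‖ * dist t s := by
    intro s t hs hst
    rw [dist_eq_norm, Real.dist_eq, abs_of_nonneg (sub_nonneg.2 hst), mul_comm]
    exact (hA.norm_flow_sub_flow_le hx hs hst).trans (mul_le_mul_of_nonneg_left
      (hA.norm_minimalSection_flow_le hx hs) (sub_nonneg.2 hst))
  refine LipschitzOnWith.continuousOn (K := ⟨‖minimalSection A x‖, norm_nonneg _⟩)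
    (LipschitzOnWith.of_dist_le_mul fun t ht s hs => ?_)
  rcases le_total s t with h | h
  · exact key s t hs h
  · rw [dist_comm, dist_comm t]
    exact key t s ht h

/-- By right differentiability, the minimal section along the flow is a pointwise limit of
continuous difference quotients. -/
theorem aestronglyMeasurable_minimalSection_flow {A : H → Set H} (hA : IsMDissipative A) {x : H}
    (hx : x ∈ domain A) : AEStronglyMeasurable (fun t => minimalSection A (flow A x t))
      (volume.restrict (Ioi (0 : ℝ))) := by
  have hc := hA.continuousOn_flow hx
  refine aestronglyMeasurable_of_tendsto_ae atTop
    (f := fun (n : ℕ) t => (1 / ((n : ℝ) + 1))⁻¹ •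
      (flow A x (t + 1 / ((n : ℝ) + 1)) - flow A x t)) (fun n => ?_) ?_
  · refine ContinuousOn.aestronglyMeasurable ?_ measurableSet_Ioi
    refine ((hc.comp (by fun_prop) fun t ht => ?_).sub
      (hc.mono Ioi_subset_Ici_self)).const_smul _
    have : (0 : ℝ) < t := ht
    exact mem_Ici.2 (by positivity)
  · filter_upwards [ae_restrict_mem measurableSet_Ioi] with t (ht : 0 < t)
    have h1 := hA.tendsto_slope_flow (hA.flow_mem_domain hx ht.le)
    have h2 : Tendsto (fun n : ℕ => 1 / ((n : ℝ) + 1)) atTop (𝓝[>] 0) :=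
      tendsto_nhdsWithin_iff.2 ⟨tendsto_one_div_add_atTop_nhds_zero_nat,
        Eventually.of_forall fun n => mem_Ioi.2 (by positivity)⟩
    refine (h1.comp h2).congr fun n => ?_
    simp only [Function.comp]
    rw [hA.flow_add hx ht.le (by positivity : 0 ≤ 1 / ((n : ℝ) + 1))]

/-- The evolution problem for an operator `A` which coincides on a closed set `K` with an
m-dissipative operator `B` whose resolvents leave `K` invariant. -/
theorem exists_unique_solution {A B : H → Set H} (hB : IsMDissipative B)
    (hA : ∀ ⦃x y a b : H⦄, a ∈ A x → b ∈ A y → ⟪a - b, x - y⟫ ≤ 0) {K : Set H}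
    (hK : IsClosed K) (hres : ∀ r : ℝ, 0 < r → MapsTo (res B r) K K)
    (hAB : ∀ x ∈ K, A x = B x) {u₀ : H} (hu₀ : u₀ ∈ domain A) (huK : u₀ ∈ K) :
    ∃ u : ℝ → H, IsSolution A u₀ u ∧
      (∀ v : ℝ → H, IsSolution A u₀ v → ∀ t : ℝ, 0 ≤ t → v t = u t) ∧
      (∀ t : ℝ, 0 ≤ t → HasDerivWithinAt u (minimalSection A (u t)) (Ici t) t) := by
  have hmin : ∀ x ∈ K, minimalSection A x = minimalSection B x := fun x hx =>
    minimalSection_congr (hAB x hx)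
  have hdom : u₀ ∈ domain B := by
    have : (A u₀).Nonempty := hu₀
    rw [hAB u₀ huK] at this
    exact this
  have hKf : ∀ t : ℝ, 0 ≤ t → flow B u₀ t ∈ K := fun t ht =>
    hB.flow_mem_of_isClosed hK hres hdom huK ht
  have hspec := fun (t : ℝ) (ht : 0 ≤ t) => hB.minimalSection_spec (hB.flow_mem_domain hdom ht)
  have hbound : ∀ᵐ t ∂(volume.restrict (Ioi (0 : ℝ))),
      ‖minimalSection B (flow B u₀ t)‖ ≤ ‖minimalSection A u₀‖ := by
    filter_upwards [ae_restrict_mem measurableSet_Ioi] with t (ht : 0 < t)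
    rw [hmin u₀ huK]
    exact hB.norm_minimalSection_flow_le hdom ht.le
  have hmem : MemLp (fun t => minimalSection B (flow B u₀ t)) ⊤
      (volume.restrict (Ioi (0 : ℝ))) :=
    memLp_top_of_bound (hB.aestronglyMeasurable_minimalSection_flow hdom) _ hbound
  have hsol : IsSolution A u₀ (flow B u₀) := by
    refine ⟨fun t ht => ?_, ⟨_, hmem, fun t ht => ?_, ?_, ?_⟩, hB.flow_zero hdom⟩
    · refine ⟨minimalSection B (flow B u₀ t), ?_⟩
      rw [hAB _ (hKf t ht.le)]
      exact (hspec t ht.le).1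
    -- The fundamental theorem of calculus needs only continuity and an integrable right derivative.
    · rw [intervalIntegral.integral_eq_sub_of_hasDeriv_right (f := flow B u₀), add_sub_cancel]
      · rw [uIcc_of_le ht]
        exact (hB.continuousOn_flow hdom).mono Icc_subset_Ici_self
      · intro s hs
        rw [min_eq_left ht] at hs
        exact (hB.hasDerivWithinAt_flow hdom hs.1.le).mono Ioi_subset_Ici_self
      · exact intervalIntegrable_of_memLp_top hmem le_rfl ht
    · rw [eLpNorm_exponent_top]
      refine eLpNormEssSup_le_of_ae_bound hbound
    · filter_upwards [ae_restrict_mem measurableSet_Ioi] with t (ht : 0 < t)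
      rw [hAB _ (hKf t ht.le)]
      exact (hspec t ht.le).1
  refine ⟨flow B u₀, hsol, fun v hv t ht => IsSolution.unique hA hv hsol ht, fun t ht => ?_⟩
  rw [hmin _ (hKf t ht)]
  exact hB.hasDerivWithinAt_flow hdom ht

end IsMDissipative

end Solutions

/-! ### Subdifferentials of convex functionals -/

section Subdifferential

/-- A strongly midpoint convex function, given by a closed set of values that contains its graph,
attains its minimum. -/
theorem exists_forall_snd_le {E : Type*} [NormedAddCommGroup E] [NormedSpace ℝ E]
    [CompleteSpace E] {S : Set (E × ℝ)} (hS : IsClosed S) (hne : S.Nonempty)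
    (h0 : ∀ p ∈ S, 0 ≤ p.2) {c : ℝ} (hc : 0 < c)
    (hmid : ∀ p ∈ S, ∀ q ∈ S,
      ((1 / 2 : ℝ) • p.1 + (1 / 2 : ℝ) • q.1, (p.2 + q.2) / 2 - c * ‖p.1 - q.1‖ ^ 2) ∈ S) :
    ∃ p ∈ S, ∀ q ∈ S, p.2 ≤ q.2 := by
  set m := sInf (Prod.snd '' S)
  have hbdd : BddBelow (Prod.snd '' S) := ⟨0, by rintro _ ⟨p, hp, rfl⟩; exact h0 p hp⟩
  have hm : ∀ q ∈ S, m ≤ q.2 := fun q hq => csInf_le hbdd ⟨q, hq, rfl⟩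
  have hex : ∀ n : ℕ, ∃ p ∈ S, p.2 < m + 1 / ((n : ℝ) + 1) := by
    intro n
    obtain ⟨_, ⟨p, hp, rfl⟩, hlt⟩ := exists_lt_of_csInf_lt (hne.image Prod.snd)
      (lt_add_of_pos_right m (by positivity : 0 < 1 / ((n : ℝ) + 1)))
    exact ⟨p, hp, hlt⟩
  choose p hpS hp using hex
  have h0' : Tendsto (fun N : ℕ => 1 / ((N : ℝ) + 1)) atTop (𝓝 0) :=
    tendsto_one_div_add_atTop_nhds_zero_nat
  -- The midpoint of two almost minimisers cannot go below the infimum, which bounds their distance.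
  have hdist : ∀ k l : ℕ, ‖(p k).1 - (p l).1‖ ^ 2 ≤
      (1 / ((k : ℝ) + 1) + 1 / ((l : ℝ) + 1)) / (2 * c) := by
    intro k l
    have h1 := hm _ (hmid _ (hpS k) _ (hpS l))
    rw [le_div_iff₀ (by positivity)]
    simp only at h1
    linarith [hp k, hp l]
  have hcauchy : CauchySeq fun n => (p n).1 := by
    rw [cauchySeq_iff_tendsto_dist_atTop_0]
    have hf : Tendsto (Prod.fst : ℕ × ℕ → ℕ) atTop atTop := by
      rw [← prod_atTop_atTop_eq]; exact tendsto_fst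
    have hs : Tendsto (Prod.snd : ℕ × ℕ → ℕ) atTop atTop := by
      rw [← prod_atTop_atTop_eq]; exact tendsto_snd
    have h3 := (((h0'.comp hf).add (h0'.comp hs)).div_const (2 * c)).sqrt
    simp only [add_zero, zero_div, Real.sqrt_zero] at h3
    refine squeeze_zero (fun _ => dist_nonneg) (fun q => ?_) h3
    rw [dist_eq_norm]
    exact Real.le_sqrt_of_sq_le (hdist _ _)
  obtain ⟨x, hx⟩ := cauchySeq_tendsto_of_complete hcauchy
  have hsnd : Tendsto (fun n => (p n).2) atTop (𝓝 m) := by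
    have h1 : Tendsto (fun N : ℕ => m + 1 / ((N : ℝ) + 1)) atTop (𝓝 (m + 0)) := h0'.const_add m
    rw [add_zero] at h1
    exact tendsto_of_tendsto_of_tendsto_of_le_of_le tendsto_const_nhds h1
      (fun n => hm _ (hpS n)) fun n => (hp n).le
  exact ⟨(x, m), hS.mem_of_tendsto (hx.prodMk_nhds hsnd) (Eventually.of_forall hpS), hm⟩

variable {H : Type*} [NormedAddCommGroup H] [InnerProductSpace ℝ H]

theorem dissipative_negSubdifferential {Φ : H → EReal} (hΦ : ∀ v, Φ v ≠ ⊥) ⦃x y a b : H⦄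
    (ha : a ∈ negSubdifferential Φ x) (hb : b ∈ negSubdifferential Φ y) :
    ⟪a - b, x - y⟫ ≤ 0 := by
  obtain ⟨hx, hax⟩ := ha
  obtain ⟨hy, hby⟩ := hb
  have h1 := hax y
  have h2 := hby x
  rw [← EReal.coe_toReal hx (hΦ x), ← EReal.coe_toReal hy (hΦ y), ← EReal.coe_add,
    EReal.coe_le_coe_iff] at h1 h2
  have e : ⟪a - b, x - y⟫ = ⟪-a, y - x⟫ + ⟪-b, x - y⟫ := by
    rw [← neg_sub x y, inner_neg_neg, inner_sub_left, inner_neg_left]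
    ring
  rw [e]
  linarith

/-- If a minimiser of `Φ + ‖· - f‖² / (2r)` always exists, then `-∂Φ` is m-dissipative. -/
theorem isMDissipative_negSubdifferential {Φ : H → EReal} (h0 : ∀ v, 0 ≤ Φ v)
    (hconv : ∀ (u v : H) (a b t : ℝ), 0 ≤ t → t ≤ 1 → Φ u ≤ a → Φ v ≤ b →
      Φ ((1 - t) • u + t • v) ≤ (((1 - t) * a + t * b : ℝ) : EReal))
    (hmin : ∀ r : ℝ, 0 < r → ∀ f : H, ∃ (w : H) (m : ℝ),
      Φ w ≤ ((m - (2 * r)⁻¹ * ‖w - f‖ ^ 2 : ℝ) : EReal) ∧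
      ∀ (v : H) (b : ℝ), Φ v ≤ b → m ≤ b + (2 * r)⁻¹ * ‖v - f‖ ^ 2) :
    IsMDissipative (negSubdifferential Φ) := by
  have hbot : ∀ v, Φ v ≠ ⊥ := fun v => ne_bot_of_le_ne_bot EReal.zero_ne_bot (h0 v)
  refine ⟨dissipative_negSubdifferential hbot, fun r hr f => ?_⟩
  obtain ⟨w, m, hw, hm⟩ := hmin r hr f
  have hwt : Φ w ≠ ⊤ := ne_top_of_le_ne_top (EReal.coe_ne_top _) hw
  refine ⟨w, hwt, fun v => ?_⟩
  by_cases hvt : Φ v = ⊤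
  · rw [hvt]; exact le_top
  obtain ⟨ρ, hρ⟩ : ∃ ρ : ℝ, Φ w = ρ := ⟨_, (EReal.coe_toReal hwt (hbot w)).symm⟩
  obtain ⟨b, hb⟩ : ∃ b : ℝ, Φ v = b := ⟨_, (EReal.coe_toReal hvt (hbot v)).symm⟩
  rw [hρ, EReal.coe_le_coe_iff] at hw
  rw [hρ, hb, ← EReal.coe_add, EReal.coe_le_coe_iff]
  -- Minimality of `w` is compared with `w + t(v - w)` and divided by `t`; letting `t → 0` gives the
  -- subgradient inequality.
  have key : ∀ t : ℝ, 0 < t → t ≤ 1 →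
      ρ - b - r⁻¹ * ⟪w - f, v - w⟫ ≤ t * ((2 * r)⁻¹ * ‖v - w‖ ^ 2) := by
    intro t ht ht1
    have h1 := hm _ _ (hconv w v ρ b t ht.le ht1 hρ.le hb.le)
    have e : (1 - t) • w + t • v - f = (w - f) + t • (v - w) := by
      rw [sub_smul, one_smul, smul_sub]; abel
    rw [e, norm_add_sq_real, real_inner_smul_right, norm_smul, Real.norm_of_nonneg ht.le] at h1
    have e2 : r⁻¹ = 2 * (2 * r)⁻¹ := by field_simp
    rw [e2]
    refine le_of_mul_le_mul_left ?_ ht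
    nlinarith
  have hle : ρ - b - r⁻¹ * ⟪w - f, v - w⟫ ≤ 0 := by
    have h1 : Tendsto (fun t : ℝ => t * ((2 * r)⁻¹ * ‖v - w‖ ^ 2)) (𝓝[>] 0)
        (𝓝 (0 * ((2 * r)⁻¹ * ‖v - w‖ ^ 2))) :=
      tendsto_nhdsWithin_of_tendsto_nhds (tendsto_id.mul_const _)
    rw [zero_mul] at h1
    refine ge_of_tendsto h1 ?_
    filter_upwards [Ioc_mem_nhdsGT (one_pos : (0 : ℝ) < 1)] with t ht using key t ht.1 ht.2
  rw [inner_neg_left, real_inner_smul_left]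
  linarith

end Subdifferential

/-! ### Pairings and the `L¹` norm on `L²` -/

section LTwo

/-- An `L²` convergent sequence has an almost everywhere convergent subsequence; Fatou's lemma
applies to it. -/
theorem lowerSemicontinuous_eLpNorm_one {α : Type*} [MeasurableSpace α] (μ : Measure α) :
    LowerSemicontinuous fun u : Lp ℝ 2 μ => eLpNorm u 1 μ := by
  rw [lowerSemicontinuous_iff_isClosed_preimage]
  intro c
  refine IsSeqClosed.isClosed fun u v hu huv => ?_
  obtain ⟨ns, -, hns⟩ := (tendstoInMeasure_of_tendsto_Lp huv).exists_seq_tendsto_ae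
  refine (Lp.eLpNorm_lim_le_liminf_eLpNorm
    (fun n => (Lp.aestronglyMeasurable (u (ns n)))) _ hns).trans ?_
  refine liminf_le_of_frequently_le' (Frequently.of_forall fun n => ?_)
  exact hu (ns n)

theorem eLpNorm_one_smul_add_smul_le {α : Type*} [MeasurableSpace α] {μ : Measure α}
    (u v : Lp ℝ 2 μ) (s t : ℝ) :
    eLpNorm (s • u + t • v : Lp ℝ 2 μ) 1 μ ≤ ‖s‖ₑ * eLpNorm u 1 μ + ‖t‖ₑ * eLpNorm v 1 μ := by
  have h1 : (s • u + t • v : Lp ℝ 2 μ) =ᵐ[μ] s • (u : α → ℝ) + t • (v : α → ℝ) :=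
    (Lp.coeFn_add _ _).trans ((Lp.coeFn_smul s u).add (Lp.coeFn_smul t v))
  rw [eLpNorm_congr_ae h1, ← eLpNorm_const_smul, ← eLpNorm_const_smul]
  exact eLpNorm_add_le ((Lp.aestronglyMeasurable u).const_smul s)
    ((Lp.aestronglyMeasurable v).const_smul t) le_rfl

/-- Turns every condition tested with smooth functions into one on inner products in `L²`, from
which closedness and linearity are immediate. -/
theorem exists_inner_eq_setIntegral (Ω : Set Plane) {D : Plane → ℝ} (hD : Continuous D)
    (hDc : HasCompactSupport D) :
    ∃ d : L2 Ω, ∀ u : L2 Ω, ∫ x in Ω, u x * D x = ⟪d, u⟫ := by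
  have hm : MemLp D 2 (volume.restrict Ω) :=
    (hD.memLp_of_hasCompactSupport hDc).mono_measure Measure.restrict_le_self
  refine ⟨hm.toLp D, fun u => ?_⟩
  rw [L2.inner_def]
  refine integral_congr_ae ?_
  filter_upwards [hm.coeFn_toLp] with x hx
  rw [hx]
  simp

theorem integrable_mul_of_hasCompactSupport {Ω : Set Plane} (u : L2 Ω) {D : Plane → ℝ}
    (hD : Continuous D) (hDc : HasCompactSupport D) :
    Integrable (fun x => u x * D x) (volume.restrict Ω) :=
  MemLp.integrable_mul (p := 2) (q := 2) (Lp.memLp u)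
    ((hD.memLp_of_hasCompactSupport hDc).mono_measure Measure.restrict_le_self)

theorem coe_ennreal_le_coe_iff (x : ℝ≥0∞) (c : ℝ) :
    (x : EReal) ≤ (c : EReal) ↔ 0 ≤ c ∧ x ≤ ENNReal.ofReal c := by
  constructor
  · intro h
    have hc : 0 ≤ c := by
      have := (EReal.coe_ennreal_nonneg x).trans h
      exact_mod_cast this
    refine ⟨hc, ?_⟩
    rw [← EReal.coe_ennreal_le_coe_ennreal_iff, EReal.coe_ennreal_ofReal, max_eq_left hc]
    exact h
  · rintro ⟨hc, h⟩
    rw [← EReal.coe_ennreal_le_coe_ennreal_iff, EReal.coe_ennreal_ofReal, max_eq_left hc] at h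
    exact h

theorem continuous_partialDeriv (i : Fin 2) {f : Plane → ℝ} {n : WithTop ℕ∞} (hn : n ≠ 0)
    (hf : ContDiff ℝ n f) : Continuous (partialDeriv i f) :=
  (hf.continuous_fderiv hn).clm_apply continuous_const

theorem hasCompactSupport_partialDeriv (i : Fin 2) {f : Plane → ℝ}
    (hf : HasCompactSupport f) : HasCompactSupport (partialDeriv i f) :=
  hf.fderiv_apply (𝕜 := ℝ) _

end LTwo

/-! ### The functional `Φ₁` -/

section PhiOne

variable {Ω : Set Plane}

/-- The graph of weak differentiation is an orthogonal complement in `L² × L²`, hence a closed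
linear subspace. -/
theorem isWeakPartial_iff (Ω : Set Plane) (i : Fin 2) :
    ∃ T : Set (L2 Ω × L2 Ω), ∀ u g : L2 Ω,
      IsWeakPartial Ω i u g ↔ ∀ d ∈ T, ⟪d.1, u⟫ + ⟪d.2, g⟫ = 0 := by
  refine ⟨{d | ∃ φ : Plane → ℝ, ContDiff ℝ ∞ φ ∧ HasCompactSupport φ ∧ tsupport φ ⊆ Ω ∧
    (∀ u : L2 Ω, ∫ x in Ω, u x * partialDeriv i φ x = ⟪d.1, u⟫) ∧
    ∀ g : L2 Ω, ∫ x in Ω, g x * φ x = ⟪d.2, g⟫}, fun u g => ⟨?_, ?_⟩⟩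
  · rintro h d ⟨φ, h1, h2, h3, h4, h5⟩
    rw [← h4, ← h5, h φ h1 h2 h3]
    ring
  · intro h φ h1 h2 h3
    obtain ⟨d, hd⟩ := exists_inner_eq_setIntegral Ω
      (continuous_partialDeriv i (by simp) h1) (hasCompactSupport_partialDeriv i h2)
    obtain ⟨e, he⟩ := exists_inner_eq_setIntegral Ω h1.continuous h2
    have := h (d, e) ⟨φ, h1, h2, h3, hd, he⟩
    rw [hd, he]
    linarith

theorem isClosed_isWeakPartial (Ω : Set Plane) (i : Fin 2) :
    IsClosed {p : L2 Ω × L2 Ω | IsWeakPartial Ω i p.1 p.2} := by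
  obtain ⟨T, hT⟩ := isWeakPartial_iff Ω i
  simp only [hT, ofPred_forall]
  refine isClosed_biInter fun d _ => isClosed_eq ?_ continuous_const
  fun_prop

theorem IsWeakPartial.smul_add_smul {i : Fin 2} {u v g k : L2 Ω} (h : IsWeakPartial Ω i u g)
    (h' : IsWeakPartial Ω i v k) (s t : ℝ) :
    IsWeakPartial Ω i (s • u + t • v) (s • g + t • k) := by
  obtain ⟨T, hT⟩ := isWeakPartial_iff Ω i
  rw [hT] at h h' ⊢
  intro d hd
  have h1 := h d hd
  have h2 := h' d hd
  simp only [inner_add_right, real_inner_smul_right]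
  linear_combination s * h1 + t * h2

theorem isWeakPartial_zero (i : Fin 2) : IsWeakPartial Ω i 0 0 := by
  obtain ⟨T, hT⟩ := isWeakPartial_iff Ω i
  rw [hT]
  simp

theorem IsWeakPartial.unique (hΩ : IsOpen Ω) {i : Fin 2} {u g k : L2 Ω}
    (h : IsWeakPartial Ω i u g) (h' : IsWeakPartial Ω i u k) : g = k := by
  have hloc : LocallyIntegrableOn (fun x => g x - k x) Ω volume := by
    refine LocallyIntegrableOn.sub ?_ ?_
    all_goals
      refine (locallyIntegrableOn_iff hΩ.isLocallyClosed).2 fun K hK hKc => ?_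
      have : IsFiniteMeasure (volume.restrict K) := ⟨by simpa using hKc.measure_lt_top⟩
      exact ((Lp.memLp _).mono_measure (Measure.restrict_mono hK le_rfl)).integrable (by norm_num)
  have h0 := hΩ.ae_eq_zero_of_integral_contDiff_smul_eq_zero hloc fun φ h1 h2 h3 => by
    have e1 := h φ h1 h2 h3
    have e2 := h' φ h1 h2 h3
    have e3 : ∫ x in Ω, (g x * φ x - k x * φ x) = 0 := by
      rw [integral_sub (integrable_mul_of_hasCompactSupport g h1.continuous h2)
        (integrable_mul_of_hasCompactSupport k h1.continuous h2)]
      linarith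
    rw [← e3, ← integral_indicator hΩ.measurableSet]
    refine integral_congr_ae (Eventually.of_forall fun x => ?_)
    by_cases hx : x ∈ Ω
    · simp only [hx, indicator_of_mem, smul_eq_mul]; ring
    · have : φ x = 0 := image_eq_zero_of_notMem_tsupport fun hx' => hx (h3 hx')
      simp [hx, this]
  refine Lp.ext ?_
  rw [Filter.EventuallyEq, ae_restrict_iff' hΩ.measurableSet]
  filter_upwards [h0] with x hx hxΩ
  linarith [hx hxΩ]

theorem lintegral_ofReal_sq_eq (g : L2 Ω) :
    ∫⁻ x in Ω, ENNReal.ofReal (g x ^ 2) = ENNReal.ofReal (‖g‖ ^ 2) := by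
  have h : Integrable (fun x => g x ^ 2) (volume.restrict Ω) := (Lp.memLp g).integrable_sq
  rw [← ofReal_integral_eq_lintegral_ofReal h (Eventually.of_forall fun x => sq_nonneg _),
    ← real_inner_self_eq_norm_sq, L2.inner_def]
  congr 1
  refine integral_congr_ae (Eventually.of_forall fun x => ?_)
  simp [sq]

theorem lintegral_ofReal_abs_eq (g : L2 Ω) :
    ∫⁻ x in Ω, ENNReal.ofReal |g x| = eLpNorm g 1 (volume.restrict Ω) := by
  rw [eLpNorm_one_eq_lintegral_enorm]
  refine lintegral_congr fun x => ?_
  rw [← Real.norm_eq_abs, ofReal_norm]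

theorem Phi1_eq (hΩ : IsOpen Ω) {γ : ℝ} (hγ : 0 < γ) {u g k : L2 Ω}
    (hg : IsWeakPartial Ω 0 u g) (hk : IsWeakPartial Ω 1 u k) :
    Phi1 Ω γ u = ((ENNReal.ofReal (γ / 2 * (‖g‖ ^ 2 + ‖k‖ ^ 2)) +
      (eLpNorm g 1 (volume.restrict Ω) + eLpNorm k 1 (volume.restrict Ω)) : ℝ≥0∞) : EReal) := by
  have h : IsH1 Ω u := ⟨![g, k], fun i => by fin_cases i <;> assumption⟩
  have e0 : h.choose 0 = g := (h.choose_spec 0).unique hΩ hg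
  have e1 : h.choose 1 = k := (h.choose_spec 1).unique hΩ hk
  rw [Phi1, dif_pos h, e0, e1]
  have hm0 := (Lp.stronglyMeasurable g).measurable
  have hm1 := (Lp.stronglyMeasurable k).measurable
  have hpt : ∀ x, ENNReal.ofReal (γ / 2 * ((g x) ^ 2 + (k x) ^ 2) + (|g x| + |k x|)) =
      ENNReal.ofReal (γ / 2) * (ENNReal.ofReal (g x ^ 2) + ENNReal.ofReal (k x ^ 2)) +
        (ENNReal.ofReal |g x| + ENNReal.ofReal |k x|) := by
    intro x
    rw [ENNReal.ofReal_add (by positivity) (by positivity), ENNReal.ofReal_mul (by positivity),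
      ENNReal.ofReal_add (by positivity) (by positivity),
      ENNReal.ofReal_add (by positivity) (by positivity)]
  simp only [hpt]
  rw [lintegral_add_left (by fun_prop), lintegral_add_left (by fun_prop),
    lintegral_const_mul _ (by fun_prop), lintegral_add_left (by fun_prop),
    lintegral_ofReal_sq_eq, lintegral_ofReal_sq_eq, lintegral_ofReal_abs_eq,
    lintegral_ofReal_abs_eq, ENNReal.ofReal_mul (by positivity),
    ENNReal.ofReal_add (by positivity) (by positivity)]

/-- Separates the quadratic part, a continuous function of the derivatives, from the `L¹` part,
which is only lower semicontinuous. The sign condition is needed because `ENNReal.ofReal` truncates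
negative numbers to `0`. -/
theorem Phi1_le_coe_iff (hΩ : IsOpen Ω) {γ : ℝ} (hγ : 0 < γ) (u : L2 Ω) (c : ℝ) :
    Phi1 Ω γ u ≤ c ↔ ∃ g k : L2 Ω, IsWeakPartial Ω 0 u g ∧ IsWeakPartial Ω 1 u k ∧
      0 ≤ c - γ / 2 * (‖g‖ ^ 2 + ‖k‖ ^ 2) ∧
      eLpNorm g 1 (volume.restrict Ω) + eLpNorm k 1 (volume.restrict Ω) ≤
        ENNReal.ofReal (c - γ / 2 * (‖g‖ ^ 2 + ‖k‖ ^ 2)) := by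
  constructor
  · intro h
    have hH : IsH1 Ω u := by
      by_contra hH
      rw [Phi1, dif_neg hH] at h
      exact EReal.coe_ne_top c (top_le_iff.1 h)
    obtain ⟨g, hg⟩ := hH
    refine ⟨g 0, g 1, hg 0, hg 1, ?_⟩
    rw [Phi1_eq hΩ hγ (hg 0) (hg 1), coe_ennreal_le_coe_iff] at h
    obtain ⟨hc, h⟩ := h
    have hq : 0 ≤ γ / 2 * (‖g 0‖ ^ 2 + ‖g 1‖ ^ 2) := by positivity
    have h1 : γ / 2 * (‖g 0‖ ^ 2 + ‖g 1‖ ^ 2) ≤ c :=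
      (ENNReal.ofReal_le_ofReal_iff hc).1 (le_self_add.trans h)
    refine ⟨sub_nonneg.2 h1, ?_⟩
    rw [ENNReal.ofReal_sub _ hq]
    exact ENNReal.le_sub_of_add_le_left ENNReal.ofReal_ne_top h
  · rintro ⟨g, k, hg, hk, h0, h⟩
    rw [Phi1_eq hΩ hγ hg hk, coe_ennreal_le_coe_iff]
    have hq : 0 ≤ γ / 2 * (‖g‖ ^ 2 + ‖k‖ ^ 2) := by positivity
    refine ⟨by linarith, ?_⟩
    refine (add_le_add_right h _).trans ?_
    rw [← ENNReal.ofReal_add hq h0, add_sub_cancel]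

theorem eLpNorm_one_pair_le {g k g' k' : L2 Ω} {a b s t : ℝ} (hs : 0 ≤ s) (ht : 0 ≤ t)
    (ha : 0 ≤ a) (hb : 0 ≤ b)
    (h : eLpNorm g 1 (volume.restrict Ω) + eLpNorm k 1 (volume.restrict Ω) ≤ ENNReal.ofReal a)
    (h' : eLpNorm g' 1 (volume.restrict Ω) + eLpNorm k' 1 (volume.restrict Ω) ≤
      ENNReal.ofReal b) :
    eLpNorm (s • g + t • g' : L2 Ω) 1 (volume.restrict Ω) +
      eLpNorm (s • k + t • k' : L2 Ω) 1 (volume.restrict Ω) ≤ ENNReal.ofReal (s * a + t * b) := by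
  refine (add_le_add (eLpNorm_one_smul_add_smul_le g g' s t)
    (eLpNorm_one_smul_add_smul_le k k' s t)).trans ?_
  rw [ENNReal.ofReal_add (by positivity) (by positivity), ENNReal.ofReal_mul hs,
    ENNReal.ofReal_mul ht, Real.enorm_of_nonneg hs, Real.enorm_of_nonneg ht]
  calc _ = ENNReal.ofReal s * (eLpNorm g 1 (volume.restrict Ω) + eLpNorm k 1 (volume.restrict Ω))
        + ENNReal.ofReal t *
          (eLpNorm g' 1 (volume.restrict Ω) + eLpNorm k' 1 (volume.restrict Ω)) := by ring
    _ ≤ _ := by gcongr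

theorem norm_convexCombination_sq {H : Type*} [NormedAddCommGroup H] [InnerProductSpace ℝ H]
    (u v : H) (t : ℝ) : ‖(1 - t) • u + t • v‖ ^ 2 =
      (1 - t) * ‖u‖ ^ 2 + t * ‖v‖ ^ 2 - t * (1 - t) * ‖u - v‖ ^ 2 := by
  rw [norm_add_sq_real, norm_sub_sq_real, norm_smul, norm_smul, real_inner_smul_left,
    real_inner_smul_right, mul_pow, mul_pow, Real.norm_eq_abs, Real.norm_eq_abs, sq_abs, sq_abs]
  ring

theorem Phi1_convex (hΩ : IsOpen Ω) {γ : ℝ} (hγ : 0 < γ) (u v : L2 Ω) (a b t : ℝ) (ht : 0 ≤ t)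
    (ht1 : t ≤ 1) (hu : Phi1 Ω γ u ≤ a) (hv : Phi1 Ω γ v ≤ b) :
    Phi1 Ω γ ((1 - t) • u + t • v) ≤ (((1 - t) * a + t * b : ℝ) : EReal) := by
  rw [Phi1_le_coe_iff hΩ hγ] at hu hv ⊢
  obtain ⟨g, k, hg, hk, h0, h⟩ := hu
  obtain ⟨g', k', hg', hk', h0', h'⟩ := hv
  have ht' : 0 ≤ 1 - t := sub_nonneg.2 ht1
  have key : (1 - t) * (a - γ / 2 * (‖g‖ ^ 2 + ‖k‖ ^ 2)) +
      t * (b - γ / 2 * (‖g'‖ ^ 2 + ‖k'‖ ^ 2)) ≤ (1 - t) * a + t * b -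
        γ / 2 * (‖(1 - t) • g + t • g'‖ ^ 2 + ‖(1 - t) • k + t • k'‖ ^ 2) := by
    rw [norm_convexCombination_sq, norm_convexCombination_sq]
    have h1 : 0 ≤ γ / 2 * (t * (1 - t) * ‖g - g'‖ ^ 2) := by positivity
    have h2 : 0 ≤ γ / 2 * (t * (1 - t) * ‖k - k'‖ ^ 2) := by positivity
    linarith
  refine ⟨_, _, hg.smul_add_smul hg' _ _, hk.smul_add_smul hk' _ _, ?_, ?_⟩
  · exact le_trans (by positivity) key
  · exact (eLpNorm_one_pair_le ht' ht h0 h0' h h').trans (ENNReal.ofReal_le_ofReal key)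

/-- With the derivatives as independent variables, the constraints are closed and the functional is
strongly convex in all three components, so `exists_forall_snd_le` applies. -/
theorem Phi1_exists_min (hΩ : IsOpen Ω) {γ : ℝ} (hγ : 0 < γ) (r : ℝ) (hr : 0 < r) (f : L2 Ω) :
    ∃ (w : L2 Ω) (m : ℝ), Phi1 Ω γ w ≤ ((m - (2 * r)⁻¹ * ‖w - f‖ ^ 2 : ℝ) : EReal) ∧
      ∀ (v : L2 Ω) (b : ℝ), Phi1 Ω γ v ≤ b → m ≤ b + (2 * r)⁻¹ * ‖v - f‖ ^ 2 := by
  set R : (L2 Ω × L2 Ω × L2 Ω) × ℝ → ℝ := fun p =>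
    p.2 - (2 * r)⁻¹ * ‖p.1.1 - f‖ ^ 2 - γ / 2 * (‖p.1.2.1‖ ^ 2 + ‖p.1.2.2‖ ^ 2) with hR
  set S : Set ((L2 Ω × L2 Ω × L2 Ω) × ℝ) := {p | IsWeakPartial Ω 0 p.1.1 p.1.2.1 ∧
    IsWeakPartial Ω 1 p.1.1 p.1.2.2 ∧ 0 ≤ R p ∧ eLpNorm p.1.2.1 1 (volume.restrict Ω) +
      eLpNorm p.1.2.2 1 (volume.restrict Ω) ≤ ENNReal.ofReal (R p)} with hS
  have hRc : Continuous R := by simp only [hR]; fun_prop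
  have hclosed : IsClosed S := by
    have h1 : IsClosed {p : (L2 Ω × L2 Ω × L2 Ω) × ℝ | IsWeakPartial Ω 0 p.1.1 p.1.2.1} :=
      (isClosed_isWeakPartial Ω 0).preimage
        (f := fun p : (L2 Ω × L2 Ω × L2 Ω) × ℝ => (p.1.1, p.1.2.1)) (by fun_prop)
    have h2 : IsClosed {p : (L2 Ω × L2 Ω × L2 Ω) × ℝ | IsWeakPartial Ω 1 p.1.1 p.1.2.2} :=
      (isClosed_isWeakPartial Ω 1).preimage
        (f := fun p : (L2 Ω × L2 Ω × L2 Ω) × ℝ => (p.1.1, p.1.2.2)) (by fun_prop)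
    have h3 : LowerSemicontinuous fun p : (L2 Ω × L2 Ω × L2 Ω) × ℝ =>
        eLpNorm p.1.2.1 1 (volume.restrict Ω) + eLpNorm p.1.2.2 1 (volume.restrict Ω) :=
      ((lowerSemicontinuous_eLpNorm_one (volume.restrict Ω)).comp (by fun_prop)).add
        ((lowerSemicontinuous_eLpNorm_one (volume.restrict Ω)).comp (by fun_prop))
    have h4 := h3.isClosed_epigraph.preimage
      (f := fun p : (L2 Ω × L2 Ω × L2 Ω) × ℝ => (p, ENNReal.ofReal (R p)))
      (continuous_id.prodMk (ENNReal.continuous_ofReal.comp hRc))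
    exact h1.inter (h2.inter ((isClosed_le continuous_const hRc).inter h4))
  -- The parallelogram law gains a quarter of the coefficients `γ/2` and `(2r)⁻¹`. The product
  -- carries the sup norm, so the smaller gain suffices.
  have hmid : ∀ p ∈ S, ∀ q ∈ S, ((1 / 2 : ℝ) • p.1 + (1 / 2 : ℝ) • q.1,
      (p.2 + q.2) / 2 - min (γ / 8) ((8 * r)⁻¹) * ‖p.1 - q.1‖ ^ 2) ∈ S := by
    rintro ⟨⟨w, g, k⟩, c⟩ ⟨h1, h2, h3, h4⟩ ⟨⟨w', g', k'⟩, c'⟩ ⟨h1', h2', h3', h4'⟩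
    have hle : min (γ / 8) ((8 * r)⁻¹) * ‖(w, g, k) - (w', g', k')‖ ^ 2 ≤
        (8 * r)⁻¹ * ‖w - w'‖ ^ 2 + γ / 8 * ‖g - g'‖ ^ 2 + γ / 8 * ‖k - k'‖ ^ 2 := by
      have ha : 0 ≤ (8 * r)⁻¹ * ‖w - w'‖ ^ 2 := by positivity
      have hb : 0 ≤ γ / 8 * ‖g - g'‖ ^ 2 := by positivity
      have hc : 0 ≤ γ / 8 * ‖k - k'‖ ^ 2 := by positivity
      have hx := min_le_left (γ / 8) ((8 * r)⁻¹)
      have hy := min_le_right (γ / 8) ((8 * r)⁻¹)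
      simp only [Prod.mk_sub_mk, Prod.norm_mk]
      rcases max_choice ‖w - w'‖ (max ‖g - g'‖ ‖k - k'‖) with h | h <;> rw [h]
      · nlinarith [mul_le_mul_of_nonneg_right hy (sq_nonneg ‖w - w'‖)]
      · rcases max_choice ‖g - g'‖ ‖k - k'‖ with h | h <;> rw [h]
        · nlinarith [mul_le_mul_of_nonneg_right hx (sq_nonneg ‖g - g'‖)]
        · nlinarith [mul_le_mul_of_nonneg_right hx (sq_nonneg ‖k - k'‖)]
    have hnorm : ∀ x y : L2 Ω, ‖(1 / 2 : ℝ) • x + (1 / 2 : ℝ) • y‖ ^ 2 =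
        (‖x‖ ^ 2 + ‖y‖ ^ 2) / 2 - ‖x - y‖ ^ 2 / 4 := by
      intro x y
      have := norm_convexCombination_sq x y (1 / 2)
      rw [show (1 - 1 / 2 : ℝ) = 1 / 2 by norm_num] at this
      rw [this]
      ring
    have hw : ‖(1 / 2 : ℝ) • w + (1 / 2 : ℝ) • w' - f‖ ^ 2 =
        (‖w - f‖ ^ 2 + ‖w' - f‖ ^ 2) / 2 - ‖w - w'‖ ^ 2 / 4 := by
      have e : (1 / 2 : ℝ) • w + (1 / 2 : ℝ) • w' - f =
          (1 / 2 : ℝ) • (w - f) + (1 / 2 : ℝ) • (w' - f) := by module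
      rw [e, hnorm, sub_sub_sub_cancel_right]
    simp only [hR] at h3 h3' h4 h4'
    have key : (1 / 2) * (c - (2 * r)⁻¹ * ‖w - f‖ ^ 2 - γ / 2 * (‖g‖ ^ 2 + ‖k‖ ^ 2)) +
        (1 / 2) * (c' - (2 * r)⁻¹ * ‖w' - f‖ ^ 2 - γ / 2 * (‖g'‖ ^ 2 + ‖k'‖ ^ 2)) ≤
        R ((1 / 2 : ℝ) • (w, g, k) + (1 / 2 : ℝ) • (w', g', k'),
          (c + c') / 2 - min (γ / 8) ((8 * r)⁻¹) * ‖(w, g, k) - (w', g', k')‖ ^ 2) := by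
      simp only [hR, Prod.smul_mk, Prod.mk_add_mk]
      rw [hw, hnorm, hnorm]
      have e : (8 * r)⁻¹ = (2 * r)⁻¹ / 4 := by field_simp; norm_num
      rw [e] at hle ⊢
      linarith
    refine ⟨h1.smul_add_smul h1' _ _, h2.smul_add_smul h2' _ _, ?_, ?_⟩
    · exact le_trans (by linarith) key
    · exact (eLpNorm_one_pair_le (by norm_num) (by norm_num) h3 h3' h4 h4').trans
        (ENNReal.ofReal_le_ofReal key)
  have hzero : eLpNorm (0 : L2 Ω) 1 (volume.restrict Ω) = 0 :=
    (eLpNorm_congr_ae (Lp.coeFn_zero ℝ 2 (volume.restrict Ω))).trans eLpNorm_zero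
  obtain ⟨⟨⟨w, g, k⟩, m⟩, ⟨h1, h2, h3, h4⟩, hm⟩ := exists_forall_snd_le hclosed
    ⟨(0, (2 * r)⁻¹ * ‖f‖ ^ 2), isWeakPartial_zero 0, isWeakPartial_zero 1,
      by simp [hR], ((congrArg₂ (· + ·) hzero hzero).trans (add_zero _)).trans_le zero_le⟩
    (fun p hp => by
      have h1 := hp.2.2.1
      have h2 : 0 ≤ (2 * r)⁻¹ * ‖p.1.1 - f‖ ^ 2 := by positivity
      have h3 : 0 ≤ γ / 2 * (‖p.1.2.1‖ ^ 2 + ‖p.1.2.2‖ ^ 2) := by positivity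
      simp only [hR] at h1
      linarith)
    (by positivity : 0 < min (γ / 8) ((8 * r)⁻¹)) hmid
  refine ⟨w, m, ?_, fun v b hv => ?_⟩
  · rw [Phi1_le_coe_iff hΩ hγ]
    exact ⟨g, k, h1, h2, h3, h4⟩
  · rw [Phi1_le_coe_iff hΩ hγ] at hv
    obtain ⟨g', k', h1', h2', h3', h4'⟩ := hv
    refine hm ((v, g', k'), b + (2 * r)⁻¹ * ‖v - f‖ ^ 2) ⟨h1', h2', ?_, ?_⟩
    · simp only [hR, add_sub_cancel_right]; exact h3'
    · simp only [hR, add_sub_cancel_right]; exact h4'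

theorem isMDissipative_Phi1 (hΩ : IsOpen Ω) {γ : ℝ} (hγ : 0 < γ) :
    IsMDissipative (negSubdifferential (Phi1 Ω γ)) :=
  isMDissipative_negSubdifferential (Phi_nonneg Ω γ 1) (Phi1_convex hΩ hγ)
    (Phi1_exists_min hΩ hγ)

end PhiOne

/-! ### The anisotropic total variation on `L²` -/

section TotalVariation

variable {Ω : Set Plane}

theorem contDiff_component {n : WithTop ℕ∞} {z : Plane → Plane} (hz : ContDiff ℝ n z)
    (i : Fin 2) : ContDiff ℝ n fun x => z x i :=
  (EuclideanSpace.proj (𝕜 := ℝ) i).contDiff.comp hz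

theorem hasCompactSupport_component {z : Plane → Plane} (hz : HasCompactSupport z) (i : Fin 2) :
    HasCompactSupport fun x => z x i :=
  hz.comp_left (g := fun y : Plane => y i) rfl

theorem continuous_divergence {z : Plane → Plane} (hz : ContDiff ℝ 1 z) :
    Continuous (divergence z) :=
  continuous_finsetSum _ fun i _ =>
    continuous_partialDeriv i one_ne_zero (contDiff_component hz i)

theorem support_divergence_subset (z : Plane → Plane) :
    Function.support (divergence z) ⊆ tsupport z := by
  intro x hx
  by_contra hxz
  refine hx (Finset.sum_eq_zero fun i _ => ?_)
  have hsub : Function.support (fun y => z y i) ⊆ Function.support z :=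
    fun y hy hy0 => hy (by simp [hy0])
  have h1 : x ∉ tsupport fun y => z y i := fun h => hxz (closure_mono hsub h)
  have h2 : fderiv ℝ (fun y => z y i) x = 0 := by
    by_contra h3
    exact h1 (support_fderiv_subset ℝ h3)
  simp [partialDeriv, h2]

theorem hasCompactSupport_divergence {z : Plane → Plane} (hz : HasCompactSupport z) :
    HasCompactSupport (divergence z) :=
  hz.mono' (support_divergence_subset z)

theorem anisoTV_le_coe_iff (u : L2 Ω) (c : ℝ) :
    anisoTV Ω u ≤ c ↔ ∀ z ∈ testFields Ω, -∫ x in Ω, u x * divergence z x ≤ c := by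
  simp only [anisoTV, iSup_le_iff, EReal.coe_le_coe_iff]

/-- The variation is a supremum of continuous linear functionals including `0`: convex, lower
semicontinuous and nonnegative. -/
theorem exists_anisoTV_le_coe_iff (Ω : Set Plane) :
    ∃ T : Set (L2 Ω), 0 ∈ T ∧ ∀ (u : L2 Ω) (c : ℝ), anisoTV Ω u ≤ c ↔ ∀ d ∈ T, ⟪d, u⟫ ≤ c := by
  refine ⟨{d | ∃ z ∈ testFields Ω, ∀ u : L2 Ω, -∫ x in Ω, u x * divergence z x = ⟪d, u⟫},
    ⟨fun _ => 0, ⟨contDiff_const, HasCompactSupport.zero, by simp [tsupport], by simp⟩,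
      fun u => by simp [divergence, partialDeriv]⟩, fun u c => ?_⟩
  rw [anisoTV_le_coe_iff]
  constructor
  · rintro h d ⟨z, hz, hd⟩
    rw [← hd]
    exact h z hz
  · intro h z hz
    obtain ⟨d, hd⟩ := exists_inner_eq_setIntegral Ω (continuous_divergence hz.1)
      (hasCompactSupport_divergence hz.2.1)
    have := h (-d) ⟨z, hz, fun v => by rw [hd, inner_neg_left]⟩
    rwa [inner_neg_left, ← hd] at this

theorem anisoTV_nonneg (u : L2 Ω) : 0 ≤ anisoTV Ω u := by
  by_contra! h
  obtain ⟨c, hc1, hc2⟩ := EReal.lt_iff_exists_real_btwn.1 h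
  obtain ⟨T, hT0, hT⟩ := exists_anisoTV_le_coe_iff Ω
  have := (hT u c).1 hc1.le 0 hT0
  rw [inner_zero_left] at this
  exact absurd hc2 (not_lt.2 (by exact_mod_cast this))

theorem isMDissipative_anisoTV (Ω : Set Plane) :
    IsMDissipative (negSubdifferential (anisoTV Ω)) := by
  obtain ⟨T, hT0, hT⟩ := exists_anisoTV_le_coe_iff Ω
  refine isMDissipative_negSubdifferential anisoTV_nonneg ?_ ?_
  · intro u v a b t ht ht1 hu hv
    rw [hT] at hu hv ⊢
    intro d hd
    rw [inner_add_right, real_inner_smul_right, real_inner_smul_right]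
    exact add_le_add (mul_le_mul_of_nonneg_left (hu d hd) (sub_nonneg.2 ht1))
      (mul_le_mul_of_nonneg_left (hv d hd) ht)
  · intro r hr f
    set S : Set (L2 Ω × ℝ) := {p | ∀ d ∈ T, ⟪d, p.1⟫ ≤ p.2 - (2 * r)⁻¹ * ‖p.1 - f‖ ^ 2} with hS
    have hclosed : IsClosed S := by
      simp only [hS, ofPred_forall]
      exact isClosed_biInter fun d _ => isClosed_le (by fun_prop) (by fun_prop)
    obtain ⟨⟨w, m⟩, hw, hm⟩ := exists_forall_snd_le hclosed
      ⟨(0, (2 * r)⁻¹ * ‖f‖ ^ 2), fun d _ => by simp⟩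
      (fun p hp => by
        have h1 := hp 0 hT0
        have h2 : 0 ≤ (2 * r)⁻¹ * ‖p.1 - f‖ ^ 2 := by positivity
        rw [inner_zero_left] at h1
        linarith)
      (c := (8 * r)⁻¹) (by positivity) (by
        rintro ⟨w, c⟩ h ⟨w', c'⟩ h' d hd
        have h1 := h d hd
        have h2 := h' d hd
        have e1 : (1 / 2 : ℝ) • w + (1 / 2 : ℝ) • w' - f =
            (1 - 1 / 2 : ℝ) • (w - f) + (1 / 2 : ℝ) • (w' - f) := by module
        have e2 : (8 * r)⁻¹ = (2 * r)⁻¹ / 4 := by field_simp; norm_num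
        simp only [inner_add_right, real_inner_smul_right] at h1 h2 ⊢
        rw [e1, norm_convexCombination_sq, sub_sub_sub_cancel_right, e2]
        linarith)
    refine ⟨w, m, (hT _ _).2 hw, fun v b hv => hm (v, _) fun d hd => ?_⟩
    rw [add_sub_cancel_right]
    exact (hT v b).1 hv d hd

end TotalVariation

/-! ### A smooth soft threshold -/

section Shrink

/-- A smooth soft threshold at level `δ`. -/
def shrink (δ s : ℝ) : ℝ := s - δ * Real.arctan (s / δ)

/-- The derivative of `shrink δ`. -/
def shrinkDeriv (δ s : ℝ) : ℝ := 1 - 1 / (1 + (s / δ) ^ 2)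

variable {δ : ℝ}

theorem hasDerivAt_shrink (hδ : 0 < δ) (s : ℝ) : HasDerivAt (shrink δ) (shrinkDeriv δ s) s := by
  have h1 := ((hasDerivAt_id s).div_const δ).arctan.const_mul δ
  have h2 := (hasDerivAt_id s).sub h1
  refine h2.congr_deriv ?_
  simp only [shrinkDeriv, id]
  field_simp

theorem shrinkDeriv_nonneg (s : ℝ) : 0 ≤ shrinkDeriv δ s := by
  rw [shrinkDeriv, sub_nonneg, div_le_one (by positivity)]
  linarith [sq_nonneg (s / δ)]

theorem shrinkDeriv_le_one (s : ℝ) : shrinkDeriv δ s ≤ 1 :=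
  sub_le_self _ (by positivity)

theorem abs_shrinkDeriv_le_one (s : ℝ) : |shrinkDeriv δ s| ≤ 1 := by
  rw [abs_of_nonneg (shrinkDeriv_nonneg s)]
  exact shrinkDeriv_le_one s

theorem shrinkDeriv_le (hδ : 0 < δ) (s : ℝ) : shrinkDeriv δ s ≤ |s| / δ := by
  rw [← abs_of_pos hδ, ← abs_div, abs_of_pos hδ, shrinkDeriv, sub_le_iff_le_add,
    ← sub_le_iff_le_add', le_div_iff₀ (by positivity)]
  rw [← sq_abs (s / δ)]
  have h := abs_nonneg (s / δ)
  set x := |s / δ|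
  nlinarith [mul_nonneg h (sq_nonneg (x - 1)), mul_nonneg h (sq_nonneg x)]

theorem contDiff_shrink {n : ℕ∞} (δ : ℝ) : ContDiff ℝ n (shrink δ) :=
  contDiff_id.sub (contDiff_const.mul (contDiff_id.div_const δ).arctan)

theorem contDiff_shrinkDeriv {n : WithTop ℕ∞} (δ : ℝ) : ContDiff ℝ n (shrinkDeriv δ) :=
  contDiff_const.sub (contDiff_const.div (contDiff_const.add ((contDiff_id.div_const δ).pow 2))
    fun s => by positivity)

theorem shrink_zero : shrink δ 0 = 0 := by simp [shrink]

theorem lipschitzWith_shrink (hδ : 0 < δ) : LipschitzWith 1 (shrink δ) := by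
  refine lipschitzWith_of_nnnorm_deriv_le (fun s => (hasDerivAt_shrink hδ s).differentiableAt)
    fun s => ?_
  rw [(hasDerivAt_shrink hδ s).deriv, ← NNReal.coe_le_coe, coe_nnnorm, Real.norm_eq_abs]
  exact abs_shrinkDeriv_le_one s

/-- The quadratic bound is what sends `L²` into `L¹`. -/
theorem abs_shrink_le (hδ : 0 < δ) (s : ℝ) : |shrink δ s| ≤ s ^ 2 / δ := by
  have h := Convex.norm_image_sub_le_of_norm_hasDerivWithin_le (f := shrink δ)
    (f' := shrinkDeriv δ) (s := Icc (-|s|) |s|) (C := |s| / δ) (x := 0) (y := s)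
    (fun x _ => (hasDerivAt_shrink hδ x).hasDerivWithinAt)
    (fun x hx => by
      rw [Real.norm_eq_abs, abs_of_nonneg (shrinkDeriv_nonneg x)]
      exact (shrinkDeriv_le hδ x).trans (div_le_div_of_nonneg_right (abs_le.2 hx) hδ.le))
    (convex_Icc _ _) (by simp) ⟨neg_abs_le s, le_abs_self s⟩
  rw [shrink_zero, sub_zero, sub_zero, Real.norm_eq_abs, Real.norm_eq_abs] at h
  refine h.trans (le_of_eq ?_)
  rw [← sq_abs]
  ring

end Shrink

/-! ### Soft thresholding does not increase the anisotropic variation -/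

section Mollification

open scoped Convolution

theorem integral_mul_divergence {f : Plane → ℝ} {z : Plane → Plane} (hf : ContDiff ℝ 1 f)
    (hz : ContDiff ℝ 1 z) (hzc : HasCompactSupport z) :
    ∫ x, f x * divergence z x = -∫ x, ∑ i : Fin 2, partialDeriv i f x * z x i := by
  have hc : ∀ i, ContDiff ℝ 1 fun y => z y i := contDiff_component hz
  have hcc : ∀ i, HasCompactSupport fun y => z y i := hasCompactSupport_component hzc
  have h1 : ∀ i, Integrable fun x => f x * partialDeriv i (fun y => z y i) x := fun i =>
    (hf.continuous.mul (continuous_partialDeriv i one_ne_zero (hc i))).integrable_of_hasCompactSupport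
      (hasCompactSupport_partialDeriv i (hcc i)).mul_left
  have h2 : ∀ i, Integrable fun x => partialDeriv i f x * z x i := fun i =>
    ((continuous_partialDeriv i one_ne_zero hf).mul
      (hc i).continuous).integrable_of_hasCompactSupport (hcc i).mul_left
  have h3 : ∀ i, Integrable fun x => f x * z x i := fun i =>
    (hf.continuous.mul (hc i).continuous).integrable_of_hasCompactSupport (hcc i).mul_left
  simp only [divergence, Finset.mul_sum]
  rw [integral_finsetSum _ fun i _ => h1 i, integral_finsetSum _ fun i _ => h2 i,
    ← Finset.sum_neg_distrib]
  refine Finset.sum_congr rfl fun i _ => ?_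
  exact integral_mul_fderiv_eq_neg_fderiv_mul_of_integrable (h2 i) (h1 i) (h3 i)
    (fun x _ => hf.differentiable one_ne_zero x)
    fun x _ => (hc i).differentiable one_ne_zero x

theorem divergence_comp_add_right (z : Plane → Plane) (t x : Plane) :
    divergence (fun y => z (y + t)) x = divergence z (x + t) := by
  simp only [divergence, partialDeriv]
  refine Finset.sum_congr rfl fun i _ => ?_
  rw [fderiv_comp_add_right (f := fun y => z y i) t]

/-- Integrals against a mollified function. -/
theorem integral_convolution_mul {φ w D : Plane → ℝ} (hφ : Integrable φ) (hw : Integrable w)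
    (hD : Continuous D) (hDc : HasCompactSupport D) :
    Integrable (fun t => φ t * ∫ x, w x * D (x + t)) ∧
    ∫ x, (φ ⋆[ContinuousLinearMap.lsmul ℝ ℝ, volume] w) x * D x =
      ∫ t, φ t * ∫ x, w x * D (x + t) := by
  obtain ⟨M, hM⟩ := hDc.exists_bound_of_continuous hD
  have hint : Integrable (fun p : Plane × Plane => (φ p.2 * w (p.1 - p.2)) * D p.1)
      (volume.prod volume) := by
    have h1 := hφ.convolution_integrand (ContinuousLinearMap.lsmul ℝ ℝ) hw
    simp only [ContinuousLinearMap.lsmul_apply, smul_eq_mul] at h1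
    exact h1.mul_bdd (c := M) (hD.comp continuous_fst).aestronglyMeasurable
      (Eventually.of_forall fun p => hM p.1)
  have hinner : ∀ t, ∫ x, (φ t * w (x - t)) * D x = φ t * ∫ x, w x * D (x + t) := by
    intro t
    simp only [mul_assoc]
    rw [integral_const_mul, ← integral_add_right_eq_self (fun x => w (x - t) * D x) t]
    simp only [add_sub_cancel_right]
  constructor
  · have h1 := hint.integral_prod_right
    simpa only [hinner] using h1
  · calc ∫ x, (φ ⋆[ContinuousLinearMap.lsmul ℝ ℝ, volume] w) x * D x
        = ∫ x, ∫ t, (φ t * w (x - t)) * D x := by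
          refine integral_congr_ae (Eventually.of_forall fun x => ?_)
          simp only [convolution_def, ContinuousLinearMap.lsmul_apply, smul_eq_mul]
          rw [integral_mul_const]
      _ = ∫ t, ∫ x, (φ t * w (x - t)) * D x := integral_integral_swap hint
      _ = _ := by simp only [hinner]

theorem continuous_integral_translate {w D : Plane → ℝ} (hw : Integrable w) (hD : Continuous D)
    (hDc : HasCompactSupport D) : Continuous fun t => ∫ x, w x * D (x + t) := by
  obtain ⟨M, hM⟩ := hDc.exists_bound_of_continuous hD
  refine continuous_of_dominated (bound := fun x => ‖w x‖ * M) (fun t => ?_) (fun t => ?_)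
    (hw.norm.mul_const M) ?_
  · exact hw.aestronglyMeasurable.mul
      (hD.comp (continuous_id.add continuous_const)).aestronglyMeasurable
  · refine Eventually.of_forall fun x => ?_
    rw [norm_mul]
    exact mul_le_mul_of_nonneg_left (hM _) (norm_nonneg _)
  · exact Eventually.of_forall fun x => continuous_const.mul (by fun_prop)

variable {Ω : Set Plane}

/-- The variation bound tested with translates of a test field. -/
theorem neg_integral_translate_le {u : L2 Ω} {c : ℝ} (hu : anisoTV Ω u ≤ c)
    {ζ : Plane → Plane} (hζ : ContDiff ℝ 1 ζ) (hζc : HasCompactSupport ζ)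
    (hζ1 : ∀ x i, |ζ x i| ≤ 1) {K : Set Plane} (hKΩ : K ⊆ Ω) {t : Plane}
    (hK : ∀ x, x + t ∈ tsupport ζ → x ∈ K) :
    -∫ x, K.indicator u x * divergence ζ (x + t) ≤ c := by
  have hsub : tsupport (fun x => ζ (x + t)) ⊆ K := fun x hx => by
    refine hK x ?_
    have := tsupport_comp_subset_preimage ζ (f := fun x => x + t) (by fun_prop) hx
    exact this
  have htest : (fun x => ζ (x + t)) ∈ testFields Ω :=
    ⟨hζ.comp (contDiff_id.add contDiff_const),
      hζc.comp_homeomorph (Homeomorph.addRight t), hsub.trans hKΩ, fun x i => hζ1 _ i⟩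
  have h1 := (anisoTV_le_coe_iff u c).1 hu _ htest
  refine le_trans (le_of_eq ?_) h1
  congr 1
  have hsupp : ∀ x, x ∉ K → divergence ζ (x + t) = 0 := by
    intro x hx
    by_contra h
    rw [← divergence_comp_add_right] at h
    exact hx (hsub (support_divergence_subset _ h))
  rw [← setIntegral_eq_integral_of_forall_compl_eq_zero (s := Ω)]
  · refine integral_congr_ae (Eventually.of_forall fun x => ?_)
    simp only [divergence_comp_add_right]
    by_cases hx : x ∈ K
    · rw [indicator_of_mem hx]
    · rw [hsupp x hx, mul_zero, mul_zero]
  · intro x hx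
    rw [hsupp x fun h => hx (hKΩ h), mul_zero]

/-- For a smooth function the chain rule moves the factor `shrinkDeriv δ`, which lies in `[0,1]`,
onto the test field, which stays admissible. The general case follows by mollification. -/
theorem neg_integral_shrink_le {u : L2 Ω} (hΩ : IsOpen Ω) {c δ : ℝ} (hδ : 0 < δ)
    (hu : anisoTV Ω u ≤ c) {z : Plane → Plane} (hz : z ∈ testFields Ω) :
    -∫ x in Ω, shrink δ (u x) * divergence z x ≤ c := by
  obtain ⟨hz1, hzc, hzΩ, hzb⟩ := hz
  obtain ⟨r, hr, hrΩ⟩ := hzc.isCompact.exists_cthickening_subset_open hΩ hzΩ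
  -- Only values of `u` near the support of `z` matter. Cutting off to a compact set inside `Ω`
  -- makes the function integrable on the plane, and shifts of length at most `r` keep translated
  -- fields supported in `K`.
  set K : Set Plane := Metric.cthickening r (tsupport z) with hKdef
  have hKc : IsCompact K := hzc.isCompact.cthickening
  set w : Plane → ℝ := K.indicator u with hw
  have hwi : Integrable w := by
    rw [hw, integrable_indicator_iff hKc.isClosed.measurableSet]
    have : IsFiniteMeasure (volume.restrict K) := ⟨by simpa using hKc.measure_lt_top⟩
    exact ((Lp.memLp u).mono_measure (Measure.restrict_mono hrΩ le_rfl)).integrable (by norm_num)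
  have hKmem : ∀ t : Plane, ‖t‖ ≤ r → ∀ x, x + t ∈ tsupport z → x ∈ K := fun t ht x hx =>
    Metric.mem_cthickening_of_dist_le x (x + t) r _ hx (by simpa [dist_eq_norm] using ht)
  set φ : ℕ → ContDiffBump (0 : Plane) := fun n =>
    ⟨r * (1 / ((n : ℝ) + 1)) / 2, r * (1 / ((n : ℝ) + 1)), by positivity,
      half_lt_self (by positivity)⟩ with hφ
  have hφle : ∀ n, (φ n).rOut ≤ r := fun n => by
    simp only [hφ]
    refine mul_le_of_le_one_right hr.le ?_
    rw [div_le_one (by positivity)]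
    linarith [(Nat.cast_nonneg n : (0 : ℝ) ≤ n)]
  have hφ0 : Tendsto (fun n => (φ n).rOut) atTop (𝓝 0) := by
    have h := (tendsto_one_div_add_atTop_nhds_zero_nat (𝕜 := ℝ)).const_mul r
    rw [mul_zero] at h
    exact h
  set W : ℕ → Plane → ℝ := fun n =>
    (φ n).normed volume ⋆[ContinuousLinearMap.lsmul ℝ ℝ, volume] w with hW
  have hW1 : ∀ n, ContDiff ℝ 1 (W n) := fun n =>
    (φ n).hasCompactSupport_normed.contDiff_convolution_left _ (φ n).contDiff_normed
      hwi.locallyIntegrable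
  have hφi : ∀ n, Integrable ((φ n).normed (volume : Measure Plane)) := fun n =>
    (φ n).integrable_normed
  -- Testing the mollified function means averaging over translates of the test field, each of which
  -- obeys the variation bound.
  have hbound : ∀ n, ∀ ζ : Plane → Plane, ContDiff ℝ 1 ζ → tsupport ζ ⊆ tsupport z →
      (∀ x i, |ζ x i| ≤ 1) → -∫ x, W n x * divergence ζ x ≤ c := by
    intro n ζ hζ hζz hζb
    have hζc : HasCompactSupport ζ := hzc.isCompact.of_isClosed_subset (isClosed_tsupport _) hζz
    obtain ⟨h1, h2⟩ := integral_convolution_mul (hφi n) hwi (continuous_divergence hζ)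
      (hasCompactSupport_divergence hζc)
    simp only [hW]
    rw [h2, ← integral_neg]
    calc ∫ t, -((φ n).normed volume t * ∫ x, w x * divergence ζ (x + t))
        ≤ ∫ t, (φ n).normed volume t * c := by
          refine integral_mono h1.neg ((hφi n).mul_const c) fun t => ?_
          by_cases ht : t ∈ Function.support ((φ n).normed volume)
          · rw [(φ n).support_normed_eq, Metric.mem_ball, dist_zero_right] at ht
            simp only
            rw [← mul_neg]
            refine mul_le_mul_of_nonneg_left ?_ ((φ n).nonneg_normed t)
            exact neg_integral_translate_le hu hζ hζc hζb hrΩ fun x hx =>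
              hKmem t (ht.le.trans (hφle n)) x (hζz hx)
          · rw [Function.notMem_support] at ht
            simp [ht]
      _ = c := by rw [integral_mul_const, (φ n).integral_normed, one_mul]
  have hchain : ∀ n, -∫ x, shrink δ (W n x) * divergence z x ≤ c := by
    intro n
    set ζ : Plane → Plane := fun x => shrinkDeriv δ (W n x) • z x with hζdef
    have hζ : ContDiff ℝ 1 ζ := ((contDiff_shrinkDeriv δ).comp (hW1 n)).smul hz1
    have hζz : tsupport ζ ⊆ tsupport z := closure_mono 
      (Function.support_smul_subset_right (fun x => shrinkDeriv δ (W n x)) z)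
    have hζc : HasCompactSupport ζ := hzc.isCompact.of_isClosed_subset (isClosed_tsupport _) hζz
    have hζb : ∀ x i, |ζ x i| ≤ 1 := fun x i => by
      simp only [hζdef, PiLp.smul_apply, smul_eq_mul, abs_mul]
      exact mul_le_one₀ (abs_shrinkDeriv_le_one _) (abs_nonneg _) (hzb x i)
    refine le_trans (le_of_eq ?_) (hbound n ζ hζ hζz hζb)
    rw [integral_mul_divergence (f := fun x => shrink δ (W n x))
      ((contDiff_shrink (n := 1) δ).comp (hW1 n)) hz1 hzc,
      integral_mul_divergence (hW1 n) hζ hζc]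
    congr 2
    refine integral_congr_ae (Eventually.of_forall fun x => Finset.sum_congr rfl fun i _ => ?_)
    have hd := (hasDerivAt_shrink hδ (W n x)).comp_hasFDerivAt x
      ((hW1 n).differentiable one_ne_zero x).hasFDerivAt
    have hd' : partialDeriv i (fun x => shrink δ (W n x)) x =
        shrinkDeriv δ (W n x) * partialDeriv i (W n) x := by
      simp only [partialDeriv]
      rw [show fderiv ℝ (fun x => shrink δ (W n x)) x = _ from hd.fderiv]
      simp
    rw [hd']
    simp only [hζdef, PiLp.smul_apply, smul_eq_mul]
    ring
  set D := divergence z with hDdef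
  have hD : Continuous D := continuous_divergence hz1
  have hDc : HasCompactSupport D := hasCompactSupport_divergence hzc
  have hDi : Integrable D := hD.integrable_of_hasCompactSupport hDc
  -- The integral is the bump convolved with the reflected function `t ↦ ∫ w(x) D(x - t)`, evaluated
  -- at `0`.
  have hlin : Tendsto (fun n => ∫ x, W n x * D x) atTop (𝓝 (∫ x, w x * D x)) := by
    have hcont := (continuous_integral_translate hwi hD hDc).comp continuous_neg
    have h1 := ContDiffBump.convolution_tendsto_right_of_continuous (μ := volume) hφ0 hcont 0
    simp only [Function.comp, neg_zero, add_zero] at h1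
    refine h1.congr fun n => ?_
    simp only [hW]
    rw [(integral_convolution_mul (hφi n) hwi hD hDc).2, convolution_def]
    simp
  have hae : ∀ᵐ x, Tendsto (fun n => W n x) atTop (𝓝 (w x)) :=
    ContDiffBump.ae_convolution_tendsto_right_of_locallyIntegrable (K := 2) hφ0
      (Eventually.of_forall fun n => by simp only [hφ]; linarith) hwi.locallyIntegrable
  have harc : Continuous fun s : ℝ => δ * Real.arctan (s / δ) := by fun_prop
  have harcb : ∀ s : ℝ, |δ * Real.arctan (s / δ)| ≤ δ * (Real.pi / 2) := fun s => by
    rw [abs_mul, abs_of_pos hδ]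
    exact mul_le_mul_of_nonneg_left (abs_le.2
      ⟨(Real.neg_pi_div_two_lt_arctan _).le, (Real.arctan_lt_pi_div_two _).le⟩) hδ.le
  -- The arctangent part is bounded, so almost everywhere convergence of the mollifications
  -- suffices.
  have hnonlin : Tendsto (fun n => ∫ x, δ * Real.arctan (W n x / δ) * D x) atTop
      (𝓝 (∫ x, δ * Real.arctan (w x / δ) * D x)) := by
    refine tendsto_integral_of_dominated_convergence (fun x => δ * (Real.pi / 2) * ‖D x‖)
      (fun n => ?_) (hDi.norm.const_mul _) (fun n => Eventually.of_forall fun x => ?_) ?_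
    · exact ((harc.comp (hW1 n).continuous).mul hD).aestronglyMeasurable
    · rw [norm_mul]
      exact mul_le_mul_of_nonneg_right (harcb _) (norm_nonneg _)
    · filter_upwards [hae] with x hx
      exact ((harc.tendsto _).comp hx).mul_const _
  have hsplit : ∀ v : Plane → ℝ, AEStronglyMeasurable v → Integrable (fun x => v x * D x) →
      ∫ x, shrink δ (v x) * D x = (∫ x, v x * D x) - ∫ x, δ * Real.arctan (v x / δ) * D x := by
    intro v hv hvi
    rw [← integral_sub hvi]
    · simp only [shrink, sub_mul]
    · exact hDi.bdd_mul (c := δ * (Real.pi / 2)) (harc.comp_aestronglyMeasurable hv)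
        (Eventually.of_forall fun x => harcb _)
  have hlim : Tendsto (fun n => -∫ x, shrink δ (W n x) * D x) atTop
      (𝓝 (-∫ x, shrink δ (w x) * D x)) := by
    obtain ⟨M, hM⟩ := hDc.exists_bound_of_continuous hD
    rw [hsplit w hwi.aestronglyMeasurable
      (hwi.mul_bdd (c := M) hD.aestronglyMeasurable (Eventually.of_forall hM))]
    refine (hlin.sub hnonlin).neg.congr fun n => ?_
    rw [hsplit (W n) (hW1 n).continuous.aestronglyMeasurable
      (((hW1 n).continuous.mul hD).integrable_of_hasCompactSupport hDc.mul_left)]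
  refine le_trans (le_of_eq ?_) (le_of_tendsto' hlim hchain)
  congr 1
  have hD0 : ∀ x, x ∉ tsupport z → D x = 0 := fun x hx => by
    by_contra h
    exact hx (support_divergence_subset z h)
  rw [← setIntegral_eq_integral_of_forall_compl_eq_zero (s := Ω)
    (f := fun x => shrink δ (w x) * D x) fun x hx => by
      rw [hD0 x fun h => hx (hzΩ h), mul_zero]]
  refine integral_congr_ae (Eventually.of_forall fun x => ?_)
  by_cases hx : x ∈ K
  · simp only [hw, indicator_of_mem hx]
  · simp only [hD0 x fun h => hx (Metric.self_subset_cthickening _ h), mul_zero]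

/-- The soft threshold of an `L²` function. -/
def shrinkLp {δ : ℝ} (hδ : 0 < δ) (u : L2 Ω) : L2 Ω :=
  (lipschitzWith_shrink hδ).compLp shrink_zero u

theorem coeFn_shrinkLp {δ : ℝ} (hδ : 0 < δ) (u : L2 Ω) :
    shrinkLp hδ u =ᵐ[volume.restrict Ω] fun x => shrink δ (u x) :=
  (lipschitzWith_shrink hδ).coeFn_compLp shrink_zero u

theorem anisoTV_shrinkLp_le (hΩ : IsOpen Ω) {δ : ℝ} (hδ : 0 < δ) (u : L2 Ω) :
    anisoTV Ω (shrinkLp hδ u) ≤ anisoTV Ω u := by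
  refine EReal.le_of_forall_lt_iff_le.1 fun c hc => ?_
  rw [anisoTV_le_coe_iff]
  intro z hz
  refine le_trans (le_of_eq ?_) (neg_integral_shrink_le hΩ hδ hc.le hz)
  congr 1
  refine integral_congr_ae ?_
  filter_upwards [coeFn_shrinkLp hδ u] with x hx
  rw [hx]

end Mollification

/-! ### The functional `Φ₀` -/

section PhiZero

variable {Ω : Set Plane}

theorem sub_shrinkLp_ae {δ : ℝ} (hδ : 0 < δ) (u : L2 Ω) :
    (u - shrinkLp hδ u : L2 Ω) =ᵐ[volume.restrict Ω] fun x => δ * Real.arctan (u x / δ) := by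
  filter_upwards [Lp.coeFn_sub u (shrinkLp hδ u), coeFn_shrinkLp hδ u] with x h1 h2
  rw [h1, Pi.sub_apply, h2, shrink]
  ring

theorem memLp_one_shrinkLp {δ : ℝ} (hδ : 0 < δ) (u : L2 Ω) :
    MemLp (shrinkLp hδ u) 1 (volume.restrict Ω) := by
  rw [memLp_one_iff_integrable]
  refine ((Lp.memLp u).integrable_sq.div_const δ).mono' (Lp.aestronglyMeasurable _) ?_
  filter_upwards [coeFn_shrinkLp hδ u] with x hx
  rw [hx]
  exact abs_shrink_le hδ _

theorem inner_eq_setIntegral (u v : L2 Ω) : ⟪u, v⟫ = ∫ x in Ω, u x * v x := by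
  rw [L2.inner_def]
  refine integral_congr_ae (Eventually.of_forall fun x => ?_)
  simp [mul_comm]

theorem abs_arctan_le (s : ℝ) : |Real.arctan s| ≤ Real.pi / 2 :=
  abs_le.2 ⟨(Real.neg_pi_div_two_lt_arctan s).le, (Real.arctan_lt_pi_div_two s).le⟩

/-- Dominated convergence: the threshold is 1-Lipschitz and fixes `0`, so `|ξ v|` dominates. -/
theorem tendsto_inner_shrinkLp (ξ v : L2 Ω) :
    Tendsto (fun n : ℕ => ⟪ξ, shrinkLp (Nat.one_div_pos_of_nat (n := n)) v⟫) atTop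
      (𝓝 ⟪ξ, v⟫) := by
  have hmul : Integrable (fun x => ξ x * v x) (volume.restrict Ω) :=
    MemLp.integrable_mul (p := 2) (q := 2) (Lp.memLp ξ) (Lp.memLp v)
  have hδ0 : Tendsto (fun n : ℕ => 1 / ((n : ℝ) + 1)) atTop (𝓝 0) :=
    tendsto_one_div_add_atTop_nhds_zero_nat
  simp only [inner_eq_setIntegral]
  refine tendsto_integral_of_dominated_convergence (fun x => ‖ξ x * v x‖) (fun n => ?_)
    hmul.norm (fun n => ?_) ?_
  · exact (Lp.aestronglyMeasurable ξ).mul (Lp.aestronglyMeasurable _)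
  · filter_upwards [coeFn_shrinkLp (Nat.one_div_pos_of_nat (n := n)) v] with x hx
    rw [hx, norm_mul, norm_mul]
    refine mul_le_mul_of_nonneg_left ?_ (norm_nonneg _)
    have := (lipschitzWith_shrink (Nat.one_div_pos_of_nat (α := ℝ) (n := n))).dist_le_mul (v x) 0
    simpa [shrink_zero, Real.dist_eq] using this
  · have h1 : ∀ᵐ x ∂(volume.restrict Ω), ∀ n : ℕ,
        shrinkLp (Nat.one_div_pos_of_nat (n := n)) v x = shrink (1 / ((n : ℝ) + 1)) (v x) :=
      ae_all_iff.2 fun n => coeFn_shrinkLp _ v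
    filter_upwards [h1] with x hx
    simp only [hx]
    refine Tendsto.const_mul _ ?_
    have h2 : Tendsto (fun n : ℕ => 1 / ((n : ℝ) + 1) * Real.arctan (v x / (1 / ((n : ℝ) + 1))))
        atTop (𝓝 0) := by
      refine squeeze_zero_norm (fun n => ?_) (by simpa using hδ0.mul_const (Real.pi / 2))
      rw [norm_mul, Real.norm_of_nonneg (by positivity), Real.norm_eq_abs, ← one_div]
      exact mul_le_mul_of_nonneg_left (abs_arctan_le _) (by positivity)
    simpa [shrink] using h2.const_sub (v x)

theorem Phi0_eq_of_memLp {u : L2 Ω} (hu : MemLp u 1 (volume.restrict Ω)) :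
    Phi0 Ω u = anisoTV Ω u := by
  by_cases h : IsBV Ω u
  · rw [Phi0, if_pos h]
  · rw [Phi0, if_neg h]
    by_contra h2
    exact h ⟨hu, lt_top_iff_ne_top.2 (Ne.symm h2)⟩

theorem anisoTV_le_Phi0 (u : L2 Ω) : anisoTV Ω u ≤ Phi0 Ω u := by
  rw [Phi0]
  split_ifs
  · exact le_rfl
  · exact le_top

/-- A subgradient inequality known on `L¹` extends to any `v ∈ L²` by testing with soft thresholds
of `v`: they lie in `L¹`, have no larger variation, and their inner products converge. -/
theorem negSubdifferential_Phi0_eq (hΩ : IsOpen Ω) {u : L2 Ω}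
    (hu : MemLp u 1 (volume.restrict Ω)) :
    negSubdifferential (Phi0 Ω) u = negSubdifferential (anisoTV Ω) u := by
  ext w
  simp only [negSubdifferential, subdifferential, mem_ofPred_eq, Phi0_eq_of_memLp hu]
  refine and_congr_right fun hfin => ⟨fun h v => ?_, fun h v => (h v).trans (anisoTV_le_Phi0 v)⟩
  have hlim : Tendsto (fun n : ℕ => anisoTV Ω u +
      ((⟪-w, shrinkLp (Nat.one_div_pos_of_nat (n := n)) v - u⟫ : ℝ) : EReal)) atTop
      (𝓝 (anisoTV Ω u + ((⟪-w, v - u⟫ : ℝ) : EReal))) := by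
    rw [← EReal.coe_toReal hfin (ne_bot_of_le_ne_bot EReal.zero_ne_bot (anisoTV_nonneg u))]
    simp only [← EReal.coe_add, inner_sub_right]
    exact (continuous_coe_real_ereal.tendsto _).comp
      (((tendsto_inner_shrinkLp (-w) v).sub_const _).const_add _)
  refine le_of_tendsto' hlim fun n => (h _).trans ?_
  rw [Phi0_eq_of_memLp (memLp_one_shrinkLp _ v)]
  exact anisoTV_shrinkLp_le hΩ _ v

/-- The resolvents of the anisotropic flow do not increase the `L¹` norm. -/
theorem eLpNorm_one_res_anisoTV_le (hΩ : IsOpen Ω) {r : ℝ} (hr : 0 < r) {f : L2 Ω}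
    (hf : MemLp f 1 (volume.restrict Ω)) :
    eLpNorm (res (negSubdifferential (anisoTV Ω)) r f : L2 Ω) 1 (volume.restrict Ω) ≤
      eLpNorm f 1 (volume.restrict Ω) := by
  obtain ⟨hfin, hsub⟩ := (isMDissipative_anisoTV Ω).yosida_mem hr f
  set w := res (negSubdifferential (anisoTV Ω)) r f with hw
  have hfi : Integrable f (volume.restrict Ω) := memLp_one_iff_integrable.1 hf
  have hkey : ∀ δ : ℝ, 0 < δ → ∫ x in Ω, w x * Real.arctan (w x / δ) ≤
      Real.pi / 2 * ∫ x in Ω, |f x| := by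
    intro δ hδ
    -- Testing the subgradient at `w` with its own soft threshold gives `⟪w - f, w - shrinkLp hδ w⟫
    -- ≤ 0`, where `w - shrinkLp hδ w = δ arctan(w/δ)` acts as a smooth sign of `w`.
    have h1 := (hsub (shrinkLp hδ w)).trans (anisoTV_shrinkLp_le hΩ hδ w)
    rw [← EReal.coe_toReal hfin (ne_bot_of_le_ne_bot EReal.zero_ne_bot (anisoTV_nonneg w)),
      ← EReal.coe_add, EReal.coe_le_coe_iff, yosida, ← hw, ← neg_sub w (shrinkLp hδ w),
      inner_neg_neg, real_inner_smul_left] at h1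
    have h2 : ⟪w - f, w - shrinkLp hδ w⟫ ≤ 0 :=
      nonpos_of_mul_nonpos_right (by linarith) (inv_pos.2 hr)
    rw [inner_sub_left, inner_eq_setIntegral, inner_eq_setIntegral, sub_nonpos] at h2
    have h3 : ∀ g : L2 Ω, ∫ x in Ω, g x * (w - shrinkLp hδ w : L2 Ω) x =
        δ * ∫ x in Ω, g x * Real.arctan (w x / δ) := fun g => by
      rw [← integral_const_mul]
      refine integral_congr_ae ?_
      filter_upwards [sub_shrinkLp_ae hδ w] with x hx
      rw [hx]
      ring
    rw [h3, h3] at h2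
    refine (le_of_mul_le_mul_left h2 hδ).trans ?_
    rw [← integral_const_mul]
    refine integral_mono (hfi.mul_bdd (c := Real.pi / 2) ?_
      (Eventually.of_forall fun x => abs_arctan_le _)) (hfi.abs.const_mul _) fun x => ?_
    · exact (Real.continuous_arctan.comp (continuous_id.div_const δ)).comp_aestronglyMeasurable
        (Lp.aestronglyMeasurable w)
    · refine (le_abs_self _).trans ?_
      rw [abs_mul, mul_comm]
      exact mul_le_mul_of_nonneg_right (abs_arctan_le _) (abs_nonneg _)
  have hwint : ∀ δ : ℝ, 0 < δ → Integrable (fun x => w x * Real.arctan (w x / δ))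
      (volume.restrict Ω) := by
    intro δ hδ
    refine (MemLp.integrable_mul (p := 2) (q := 2) (Lp.memLp w)
      ((Lp.memLp (w - shrinkLp hδ w)).const_mul δ⁻¹)).congr ?_
    filter_upwards [sub_shrinkLp_ae hδ w] with x hx
    rw [Pi.mul_apply, hx, inv_mul_cancel_left₀ hδ.ne']
  have hnn : ∀ δ : ℝ, 0 < δ → ∀ s : ℝ, 0 ≤ s * Real.arctan (s / δ) := by
    intro δ hδ s
    rcases le_total 0 s with h | h
    · exact mul_nonneg h (Real.arctan_nonneg.2 (div_nonneg h hδ.le))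
    · exact mul_nonneg_of_nonpos_of_nonpos h
        (Real.arctan_zero ▸ Real.arctan_mono (div_nonpos_of_nonpos_of_nonneg h hδ.le))
  -- As `δ → 0` the integrand `w arctan(w/δ)` tends to `(π/2)|w|`. Fatou's lemma is used because `w
  -- ∈ L¹` is not yet known.
  have hfatou : ∫⁻ x in Ω, ENNReal.ofReal (Real.pi / 2 * |w x|) ≤
      ENNReal.ofReal (Real.pi / 2 * ∫ x in Ω, |f x|) := by
    have hpt : ∀ s : ℝ, Tendsto (fun n : ℕ => ENNReal.ofReal
        (s * Real.arctan (s / (1 / ((n : ℝ) + 1))))) atTop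
        (𝓝 (ENNReal.ofReal (Real.pi / 2 * |s|))) := by
      intro s
      refine (ENNReal.continuous_ofReal.tendsto _).comp ?_
      have hinf : Tendsto (fun n : ℕ => (n : ℝ) + 1) atTop atTop :=
        tendsto_atTop_add_const_right _ _ tendsto_natCast_atTop_atTop
      simp only [div_div_eq_mul_div, div_one]
      rcases lt_trichotomy s 0 with hs | rfl | hs
      · have h1 := (Real.tendsto_arctan_atBot.mono_right nhdsWithin_le_nhds).comp
          (hinf.const_mul_atTop_of_neg hs)
        rw [abs_of_neg hs, mul_neg, ← neg_mul, mul_comm]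
        exact h1.const_mul s
      · simp
      · have h1 := (Real.tendsto_arctan_atTop.mono_right nhdsWithin_le_nhds).comp
          (hinf.const_mul_atTop hs)
        rw [abs_of_pos hs, mul_comm]
        exact h1.const_mul s
    have hmeas : ∀ n : ℕ, Measurable fun x => ENNReal.ofReal
        (w x * Real.arctan (w x / (1 / ((n : ℝ) + 1)))) := fun n => by
      have := (Lp.stronglyMeasurable w).measurable
      exact (this.mul (Real.measurable_arctan.comp (this.div_const _))).ennreal_ofReal
    calc ∫⁻ x in Ω, ENNReal.ofReal (Real.pi / 2 * |w x|)
        = ∫⁻ x in Ω, liminf (fun n : ℕ => ENNReal.ofReal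
            (w x * Real.arctan (w x / (1 / ((n : ℝ) + 1))))) atTop :=
          lintegral_congr fun x => (hpt (w x)).liminf_eq.symm
      _ ≤ liminf (fun n : ℕ => ∫⁻ x in Ω, ENNReal.ofReal
            (w x * Real.arctan (w x / (1 / ((n : ℝ) + 1))))) atTop :=
          lintegral_liminf_le hmeas
      _ ≤ _ := by
          refine liminf_le_of_frequently_le' (Frequently.of_forall fun n => ?_)
          have hn : (0 : ℝ) < 1 / ((n : ℝ) + 1) := Nat.one_div_pos_of_nat
          rw [← ofReal_integral_eq_lintegral_ofReal (hwint _ hn)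
            (Eventually.of_forall fun x => hnn _ hn _)]
          exact ENNReal.ofReal_le_ofReal (hkey _ hn)
  have hpi : 0 < Real.pi / 2 := by positivity
  simp only [ENNReal.ofReal_mul hpi.le] at hfatou
  rw [lintegral_const_mul' _ _ ENNReal.ofReal_ne_top,
    ENNReal.mul_le_mul_iff_right (ENNReal.ofReal_pos.2 hpi).ne' ENNReal.ofReal_ne_top,
    lintegral_ofReal_abs_eq,
    ofReal_integral_eq_lintegral_ofReal hfi.abs (Eventually.of_forall fun x => abs_nonneg _),
    lintegral_ofReal_abs_eq] at hfatou
  exact hfatou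

end PhiZero

end AnisoFlow

end

theorem mainTheorem1 (Ω : Set AnisoFlow.Plane) (hΩ : IsOpen Ω) (γ : ℝ) (hγ : 0 < γ)
    (i : Fin 2) (u₀ : AnisoFlow.L2 Ω) (hu₀ : u₀ ∈ AnisoFlow.domain (AnisoFlow.opA Ω γ i)) :
    ∃ u : ℝ → AnisoFlow.L2 Ω,
      AnisoFlow.IsSolution (AnisoFlow.opA Ω γ i) u₀ u ∧
      (∀ v : ℝ → AnisoFlow.L2 Ω, AnisoFlow.IsSolution (AnisoFlow.opA Ω γ i) u₀ v →
        ∀ t : ℝ, 0 ≤ t → v t = u t) ∧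
      (∀ t : ℝ, 0 ≤ t →
        HasDerivWithinAt u (AnisoFlow.minimalSection (AnisoFlow.opA Ω γ i) (u t))
          (Set.Ici t) t) := by
  have hdiss : ∀ ⦃x y a b : AnisoFlow.L2 Ω⦄, a ∈ AnisoFlow.opA Ω γ i x →
      b ∈ AnisoFlow.opA Ω γ i y → inner ℝ (a - b) (x - y) ≤ 0 :=
    AnisoFlow.dissipative_negSubdifferential fun v =>
      ne_bot_of_le_ne_bot EReal.zero_ne_bot (AnisoFlow.Phi_nonneg Ω γ i v)
  fin_cases i
  · have huBV : AnisoFlow.IsBV Ω u₀ := by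
      obtain ⟨w, hw, -⟩ := hu₀
      by_contra h
      exact hw (if_neg h)
    -- The closed set is the `L¹` ball with radius the norm of `u₀`, which is finite because the
    -- domain lies in `BV`.
    refine (AnisoFlow.isMDissipative_anisoTV Ω).exists_unique_solution hdiss
      (K := {u | eLpNorm u 1 (volume.restrict Ω) ≤ eLpNorm u₀ 1 (volume.restrict Ω)})
      ((AnisoFlow.lowerSemicontinuous_eLpNorm_one _).isClosed_preimage _)
      (fun r hr f hf => ?_) (fun x hx => ?_) hu₀ (le_refl (eLpNorm u₀ 1 (volume.restrict Ω)))
    · exact (AnisoFlow.eLpNorm_one_res_anisoTV_le hΩ hr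
        ⟨Lp.aestronglyMeasurable f, lt_of_le_of_lt hf huBV.1.2⟩).trans hf
    · exact AnisoFlow.negSubdifferential_Phi0_eq hΩ
        ⟨Lp.aestronglyMeasurable x, lt_of_le_of_lt hx huBV.1.2⟩
  · exact (AnisoFlow.isMDissipative_Phi1 hΩ hγ).exists_unique_solution hdiss isClosed_univ
      (fun _ _ => mapsTo_univ _ _) (fun _ _ => rfl) hu₀ (mem_univ _)
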